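/- **Theorem (balanced connected subgraphs of circular-arc graphs).** A *circular-arc graph* is the intersection graph $G$ of $n$ closed arcs on a circle: its vertices are the arcs, and two distinct arcs are adjacent if and only if they have a common point. Let each vertex of $G$ be colored red or blue. The *Balanced Connected Subgraph* problem (BCS) asks for a vertex set $H$ of maximum cardinality such that $H$ contains equally many red and blue vertices and the induced subgraph $G[H]$ is connected (the empty set is admitted, and is the answer if there is no nonempty such set). The graph is given by its arcs: the input consists of $n$, the circumference $L\ge 1$ of the circle and, for each arc $i$, its color and two integers $l_i, r_i$ with $0\le l_i<L$ and $l_i\le r_i\le l_i+L$, meaning that arc $i$ is the image of $[l_i,r_i]$ in the circle $\mathbb R/L\mathbb Z$. Then BCS on $n$-vertex red/blue-colored circular-arc graphs can be solved in $\mathcal O(n^6\log n)$ time on a word RAM. That is, there are a fixed program $P$, a number $k$ and a function $T:\mathbb N\to\mathbb N$ with $T(n)=\mathcal O(n^6\log n)$ as $n\to\infty$ such that, for every $n$, every such input with $n$ arcs, and every bound $W\ge (n+2)^k$ on the size of the machine words with $L<W$ and $r_i<W$ for all $i$, the program $P$ started on this input halts after at most $T(n)$ steps, never produces a word that is $W$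 or larger, and outputs a maximum-cardinality vertex set $H$ that is color-balanced and induces a connected subgraph of $G$. Every constant, register or memory access, addition, truncated subtraction, multiplication, comparison, Boolean operation, assignment and branch counts as one step. -/

import Mathlib

open Filter Asymptotics

namespace BCS

/-! ### Bicolored graphs and balanced connected subgraphs -/

/-- The two vertex colors. -/
inductive Color where
  | red
  | blue
  deriving DecidableEq

/-- The intersection graph of a family of sets: distinct indices are adjacent when the
corresponding sets have a common point. -/
def intersectionGraph {ι X : Type*} (A : ι → Set X) : SimpleGraph ι where
  Adj i j := i ≠ j ∧ (A i ∩ A j).Nonempty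
  symm := ⟨fun _ _ h => ⟨h.1.symm, by rw [Set.inter_comm]; exact h.2⟩⟩
  loopless := ⟨fun _ h => h.1 rfl⟩

/-- `H` contains as many red as blue vertices. -/
def IsBalanced {V : Type*} (c : V → Color) (H : Finset V) : Prop :=
  (H.filter fun v => c v = Color.red).card = (H.filter fun v => c v = Color.blue).card

/-- The vertex set `H` induces a color-balanced connected subgraph of `G`. `Preconnected` says
that any two vertices are joined by a path, so the empty vertex set is admitted: it is the
solution of an instance without nonempty balanced connected subgraph. -/
def IsBalancedConnected {V : Type*} (G : SimpleGraph V) (c : V → Color) (H : Finset V) : Prop :=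
  (G.induce (H : Set V)).Preconnected ∧ IsBalanced c H

/-- `H` is an optimal solution of the balanced connected subgraph problem on `(G, c)`. -/
def IsMaximumBCS {V : Type*} (G : SimpleGraph V) (c : V → Color) (H : Finset V) : Prop :=
  IsBalancedConnected G c H ∧ ∀ H' : Finset V, IsBalancedConnected G c H' → H'.card ≤ H.card

/-! ### Bicolored families of arcs on a circle -/

/-- A red/blue colored family of `n` closed arcs on a circle of circumference `len`, with
integer endpoints. Going clockwise, arc `i` starts at position `left i` and ends at position
`right i`, where positions are counted modulo `len`; `right i` is at most `len` further than
`left i`. Single points (`right i = left i`) and full circles (`right i = left i + len`) are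
allowed. -/
structure ColoredArcs (n : ℕ) where
  len : ℕ
  left : Fin n → ℕ
  right : Fin n → ℕ
  color : Fin n → Color
  len_pos : 0 < len
  left_lt : ∀ i, left i < len
  left_le_right : ∀ i, left i ≤ right i
  right_le : ∀ i, right i ≤ left i + len

namespace ColoredArcs

variable {n : ℕ}

/-- The `i`-th arc, as a subset of the circle `ℝ / len ℤ`. -/
def arc (I : ColoredArcs n) (i : Fin n) : Set (AddCircle (I.len : ℝ)) :=
  (fun x : ℝ => (x : AddCircle (I.len : ℝ))) '' Set.Icc (I.left i : ℝ) (I.right i : ℝ)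

/-- The circular-arc graph of the family. -/
def graph (I : ColoredArcs n) : SimpleGraph (Fin n) :=
  intersectionGraph I.arc

end ColoredArcs

/-! ### The word RAM

A state has registers and a random-access memory, both holding natural numbers (words). Programs
are built from assignments, memory writes, branching and loops. All words that occur must be
smaller than a bound `W`, a computation that would produce a larger word is stuck. Every constant,
register access, memory access, arithmetic operation, comparison, Boolean operation, assignment
and branch costs one unit of time. -/

structure State where
  reg : ℕ → ℕ
  mem : ℕ → ℕ

/-- Arithmetic expressions; `load e` reads the memory at address `e`. -/
inductive Exp where
  | const (c : ℕ)
  | reg (r : ℕ)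
  | load (e : Exp)
  | add (e₁ e₂ : Exp)
  | sub (e₁ e₂ : Exp)
  | mul (e₁ e₂ : Exp)

namespace Exp

/-- The value of an expression (subtraction is truncated at `0`). -/
def eval (s : State) : Exp → ℕ
  | const c => c
  | reg r => s.reg r
  | load e => s.mem (e.eval s)
  | add e₁ e₂ => e₁.eval s + e₂.eval s
  | sub e₁ e₂ => e₁.eval s - e₂.eval s
  | mul e₁ e₂ => e₁.eval s * e₂.eval s

/-- The values of the expression and of all its subexpressions are smaller than `W`. -/
def Fits (W : ℕ) (s : State) : Exp → Prop
  | const c => c < W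
  | reg r => s.reg r < W
  | load e => e.Fits W s ∧ s.mem (e.eval s) < W
  | add e₁ e₂ => e₁.Fits W s ∧ e₂.Fits W s ∧ e₁.eval s + e₂.eval s < W
  | sub e₁ e₂ => e₁.Fits W s ∧ e₂.Fits W s ∧ e₁.eval s - e₂.eval s < W
  | mul e₁ e₂ => e₁.Fits W s ∧ e₂.Fits W s ∧ e₁.eval s * e₂.eval s < W

/-- The time for evaluating an expression. -/
def cost : Exp → ℕ
  | const _ => 1
  | reg _ => 1
  | load e => e.cost + 1
  | add e₁ e₂ => e₁.cost + e₂.cost + 1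
  | sub e₁ e₂ => e₁.cost + e₂.cost + 1
  | mul e₁ e₂ => e₁.cost + e₂.cost + 1

end Exp

/-- Tests. -/
inductive Test where
  | lt (e₁ e₂ : Exp)
  | eq (e₁ e₂ : Exp)
  | not (b : Test)
  | and (b₁ b₂ : Test)

namespace Test

def Holds (s : State) : Test → Prop
  | lt e₁ e₂ => e₁.eval s < e₂.eval s
  | eq e₁ e₂ => e₁.eval s = e₂.eval s
  | not b => ¬ b.Holds s
  | and b₁ b₂ => b₁.Holds s ∧ b₂.Holds s

def Fits (W : ℕ) (s : State) : Test → Prop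
  | lt e₁ e₂ => e₁.Fits W s ∧ e₂.Fits W s
  | eq e₁ e₂ => e₁.Fits W s ∧ e₂.Fits W s
  | not b => b.Fits W s
  | and b₁ b₂ => b₁.Fits W s ∧ b₂.Fits W s

def cost : Test → ℕ
  | lt e₁ e₂ => e₁.cost + e₂.cost + 1
  | eq e₁ e₂ => e₁.cost + e₂.cost + 1
  | not b => b.cost + 1
  | and b₁ b₂ => b₁.cost + b₂.cost + 1

end Test

/-- Programs. `assign r e` puts the value of `e` into register `r`; `store a e` writes the value
of `e` to the memory at address `a`; `loop b p` repeats `p` as long as `b` holds. -/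
inductive Program where
  | skip
  | assign (r : ℕ) (e : Exp)
  | store (a e : Exp)
  | seq (p q : Program)
  | branch (b : Test) (p q : Program)
  | loop (b : Test) (p : Program)

/-- `Exec W p s t s'`: with words bounded by `W`, the program `p` started in state `s` halts after
exactly `t` units of time in state `s'`. -/
inductive Exec (W : ℕ) : Program → State → ℕ → State → Prop where
  | skip (s : State) : Exec W Program.skip s 1 s
  | assign (r : ℕ) (e : Exp) (s : State) (h : e.Fits W s) :
      Exec W (Program.assign r e) s (e.cost + 1)
        { reg := Function.update s.reg r (e.eval s), mem := s.mem }
  | store (a e : Exp) (s : State) (ha : a.Fits W s) (he : e.Fits W s) :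
      Exec W (Program.store a e) s (a.cost + e.cost + 1)
        { reg := s.reg, mem := Function.update s.mem (a.eval s) (e.eval s) }
  | seq (p q : Program) (s s₁ s₂ : State) (t₁ t₂ : ℕ)
      (hp : Exec W p s t₁ s₁) (hq : Exec W q s₁ t₂ s₂) :
      Exec W (Program.seq p q) s (t₁ + t₂) s₂
  | branch_true (b : Test) (p q : Program) (s s₁ : State) (t : ℕ)
      (hf : b.Fits W s) (hb : b.Holds s) (hp : Exec W p s t s₁) :
      Exec W (Program.branch b p q) s (b.cost + 1 + t) s₁
  | branch_false (b : Test) (p q : Program) (s s₁ : State) (t : ℕ)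
      (hf : b.Fits W s) (hb : ¬ b.Holds s) (hq : Exec W q s t s₁) :
      Exec W (Program.branch b p q) s (b.cost + 1 + t) s₁
  | loop_true (b : Test) (p : Program) (s s₁ s₂ : State) (t₁ t₂ : ℕ)
      (hf : b.Fits W s) (hb : b.Holds s) (hp : Exec W p s t₁ s₁)
      (hl : Exec W (Program.loop b p) s₁ t₂ s₂) :
      Exec W (Program.loop b p) s (b.cost + 1 + t₁ + t₂) s₂
  | loop_false (b : Test) (p : Program) (s : State)
      (hf : b.Fits W s) (hb : ¬ b.Holds s) :
      Exec W (Program.loop b p) s (b.cost + 1) s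

/-! ### Input and output of the problem -/

namespace ColoredArcs

variable {n : ℕ}

/-- The input words: `n`, the circumference, and then for each arc its two endpoints and its color
(`1` for red, `0` for blue). All other memory cells are `0`. -/
def inputMem (I : ColoredArcs n) : ℕ → ℕ
  | 0 => n
  | 1 => I.len
  | a + 2 =>
    if h : a / 3 < n then
      if a % 3 = 0 then I.left ⟨a / 3, h⟩
      else if a % 3 = 1 then I.right ⟨a / 3, h⟩
      else if I.color ⟨a / 3, h⟩ = Color.red then 1 else 0
    else 0

/-- The initial state on input `I`: all registers are `0`, the memory holds the input. -/
def inputState (I : ColoredArcs n) : State where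
  reg := fun _ => 0
  mem := I.inputMem

end ColoredArcs

/-- The set of vertices returned by a computation: vertex `i` belongs to it when the `i`-th of the
`n` memory cells behind the `3 n + 2` input cells holds `1`. -/
def State.output (s : State) (n : ℕ) : Finset (Fin n) :=
  Finset.univ.filter fun i : Fin n => s.mem (2 + 3 * n + i.val) = 1

end BCS

/-!
The proof gives an explicit program and an `O(n^6)` bound on its running time.

*Connectivity.* Direct the graph by `ColoredArcs.Hits`: arc `i` points to arc `j` when it contains
the left endpoint of `j`. Two arcs meet exactly when one of them points to the other, and two arcs
pointing to the same arc meet (`Hits.comparable`). Hence every nonempty connected set `H` has a root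
`u` from which all of `H` is reached inside `H` (`exists_root`): take a vertex with maximal reach.
Order the arcs by the clockwise distance of their left endpoints from that of `u`, and let `v` be
the last arc of `H`. Then `H` lies in the window of all arcs up to `v`. Conversely, a walk from `u`
to `v` sweeps over all left endpoints of the window, so a vertex set of such a walk stays connected
when any arcs of the window are added (`Spans.preconnected`). It does not matter whether `H` covers
the circle.

*Optimization.* Let `c` be a majority color of the window and let `m` be the number of its arcs of
the other color. No balanced subset of the window has more than `2 * m` arcs. If `H` exists, it
contains a walk from `u` to `v` with at most `m` arcs of color `c`; and a walk inside the window
with at most `m` arcs of color `c` extends to a balanced connected set with `2 * m` arcs, by adding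
all arcs of the other color and as many arcs of color `c` as needed. So the optimum is the largest
`2 * m` over all `u`, `v`, `c` that admit such a walk (`Candidate`, `exists_candidate`).

*Running time.* For each of the `O(n ^ 2)` choices the Bellman-Ford algorithm makes `n ^ 3` attempts
at an improvement (`WP.relax`, `Lower.succ`). The vertex set of an improved walk is copied, which
costs `O(n)` but spares the tracing of predecessors. All loops run over `0, …, n - 1`, so the time
is bounded by a polynomial whose degree is the loop depth, which is `6` (`exists_time_le`).
Correctness is shown with the weakest preconditions `WP`.
-/

namespace BCS

/-! ### Running time and weakest preconditions of word RAM programs -/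

namespace Program

/-- The registers that a program assigns to. -/
def writes : Program → List ℕ
  | skip => []
  | assign r _ => [r]
  | store _ _ => []
  | seq p q => p.writes ++ q.writes
  | branch _ p q => p.writes ++ q.writes
  | loop _ p => p.writes

/-- A bound for the running time of a program each of whose loops makes at most `n` rounds whenever
it is entered; of a branch both alternatives are counted. -/
def time (n : ℕ) : Program → ℕ
  | skip => 1
  | assign _ e => e.cost + 1
  | store a e => a.cost + e.cost + 1
  | seq p q => p.time n + q.time n
  | branch b p q => b.cost + 1 + (p.time n + q.time n)
  | loop b p => n * (b.cost + 1 + p.time n) + (b.cost + 1)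

/-- The nesting depth of the loops. -/
def depth : Program → ℕ
  | skip => 0
  | assign _ _ => 0
  | store _ _ => 0
  | seq p q => max p.depth q.depth
  | branch _ p q => max p.depth q.depth
  | loop _ p => p.depth + 1

/-- `time` is bounded by a polynomial whose degree is the nesting depth of the loops. -/
theorem exists_time_le (p : Program) : ∃ C, ∀ n, p.time n ≤ C * (n + 1) ^ p.depth := by
  have key : ∀ (C n a b : ℕ), a ≤ b → C * (n + 1) ^ a ≤ C * (n + 1) ^ b := fun C n a b h =>
    Nat.mul_le_mul_left _ (Nat.pow_le_pow_right (Nat.succ_pos n) h)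
  induction p with
  | skip => exact ⟨1, fun n => by simp [time, depth]⟩
  | assign r e => exact ⟨e.cost + 1, fun n => by simp [time, depth]⟩
  | store a e => exact ⟨a.cost + e.cost + 1, fun n => by simp [time, depth]⟩
  | seq p q hp hq =>
    obtain ⟨C, hC⟩ := hp
    obtain ⟨D, hD⟩ := hq
    refine ⟨C + D, fun n => ?_⟩
    have h1 := (hC n).trans (key C n _ _ (le_max_left p.depth q.depth))
    have h2 := (hD n).trans (key D n _ _ (le_max_right p.depth q.depth))
    simp only [time, depth, add_mul]
    omega
  | branch b p q hp hq =>
    obtain ⟨C, hC⟩ := hp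
    obtain ⟨D, hD⟩ := hq
    refine ⟨b.cost + 1 + (C + D), fun n => ?_⟩
    have h1 := (hC n).trans (key C n _ _ (le_max_left p.depth q.depth))
    have h2 := (hD n).trans (key D n _ _ (le_max_right p.depth q.depth))
    have h3 := key (b.cost + 1) n 0 _ (Nat.zero_le (max p.depth q.depth))
    simp only [time, depth, add_mul, pow_zero, mul_one] at *
    omega
  | loop b p hp =>
    obtain ⟨C, hC⟩ := hp
    refine ⟨b.cost + 1 + C, fun n => ?_⟩
    have h1 := hC n
    have h3 := key (b.cost + 1) n 0 _ (Nat.zero_le p.depth)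
    have h4 : b.cost + 1 + p.time n ≤ (b.cost + 1 + C) * (n + 1) ^ p.depth := by
      simp only [add_mul, pow_zero, mul_one] at *
      omega
    have h5 := Nat.mul_le_mul_left n h4
    simp only [time, depth]
    rw [pow_succ]
    calc _ ≤ n * ((b.cost + 1 + C) * (n + 1) ^ p.depth)
          + (b.cost + 1 + C) * (n + 1) ^ p.depth := by omega
      _ = _ := by ring

/-- `for r = 0, …, n - 1 do p`, where register `0` holds `n`. -/
def forLoop (r : ℕ) (p : Program) : Program :=
  seq (assign r (Exp.const 0))
    (loop (Test.lt (Exp.reg r) (Exp.reg 0)) (seq p (assign r (Exp.add (Exp.reg r) (Exp.const 1)))))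

end Program

/-- All words of the state are smaller than `W`, and register `0` holds `n`. -/
structure State.Ok (W n : ℕ) (s : State) : Prop where
  reg_lt : ∀ r, s.reg r < W
  mem_lt : ∀ a, s.mem a < W
  reg_zero : s.reg 0 = n

/-- Assignment to a register. -/
def State.set (s : State) (r v : ℕ) : State := { reg := Function.update s.reg r v, mem := s.mem }

/-- Writing to a memory cell. -/
def State.put (s : State) (a v : ℕ) : State := { reg := s.reg, mem := Function.update s.mem a v }

@[simp] theorem State.set_reg (s : State) (r v r' : ℕ) :
    (s.set r v).reg r' = if r' = r then v else s.reg r' := by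
  simp [State.set, Function.update_apply]

@[simp] theorem State.set_mem (s : State) (r v : ℕ) : (s.set r v).mem = s.mem := rfl

@[simp] theorem State.put_reg (s : State) (a v : ℕ) : (s.put a v).reg = s.reg := rfl

theorem State.put_mem (s : State) (a v a' : ℕ) :
    (s.put a v).mem a' = if a' = a then v else s.mem a' := by
  simp [State.put, Function.update_apply]

theorem State.Ok.set {W n r v : ℕ} {s : State} (h : s.Ok W n) (hr : r ≠ 0) (hv : v < W) :
    (s.set r v).Ok W n where
  reg_lt r' := by
    rw [State.set_reg]
    split_ifs
    exacts [hv, h.reg_lt r']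
  mem_lt := h.mem_lt
  reg_zero := by simp [hr.symm, h.reg_zero]

theorem State.Ok.put {W n a v : ℕ} {s : State} (h : s.Ok W n) (hv : v < W) :
    (s.put a v).Ok W n where
  reg_lt := h.reg_lt
  mem_lt a' := by
    rw [State.put_mem]
    split_ifs
    exacts [hv, h.mem_lt a']
  reg_zero := h.reg_zero

theorem Exp.Fits.eval_lt {W : ℕ} {s : State} {e : Exp} (h : e.Fits W s) : e.eval s < W := by
  cases e with
  | const c => exact h
  | reg r => exact h
  | load e => exact h.2
  | add a b => exact h.2.2
  | sub a b => exact h.2.2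
  | mul a b => exact h.2.2

theorem Exec.reg_eq {W t : ℕ} {p : Program} {s s' : State} (h : Exec W p s t s') :
    ∀ r, r ∉ p.writes → s'.reg r = s.reg r := by
  induction h with
  | skip => intros; rfl
  | assign r e s h =>
    intro r' hr'
    simp only [Program.writes, List.mem_singleton] at hr'
    simp [Function.update_of_ne hr']
  | store => intros; rfl
  | seq p q s s₁ s₂ t₁ t₂ _ _ ihp ihq =>
    intro r hr
    simp only [Program.writes, List.mem_append, not_or] at hr
    rw [ihq r hr.2, ihp r hr.1]
  | branch_true b p q s s₁ t _ _ _ ih =>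
    intro r hr
    simp only [Program.writes, List.mem_append, not_or] at hr
    exact ih r hr.1
  | branch_false b p q s s₁ t _ _ _ ih =>
    intro r hr
    simp only [Program.writes, List.mem_append, not_or] at hr
    exact ih r hr.2
  | loop_true b p s s₁ s₂ t₁ t₂ _ _ _ _ ihp ihl =>
    intro r hr
    rw [ihl r hr, ihp r hr]
  | loop_false => intros; rfl

theorem Exec.lt_bound {W t : ℕ} {p : Program} {s s' : State} (h : Exec W p s t s') :
    ((∀ r, s.reg r < W) ∧ ∀ a, s.mem a < W) → (∀ r, s'.reg r < W) ∧ ∀ a, s'.mem a < W := by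
  induction h with
  | skip => exact id
  | assign r e s h =>
    refine fun hs => ⟨fun r' => ?_, hs.2⟩
    simp only [Function.update_apply]
    split_ifs
    exacts [h.eval_lt, hs.1 r']
  | store a e s ha he =>
    refine fun hs => ⟨hs.1, fun a' => ?_⟩
    simp only [Function.update_apply]
    split_ifs
    exacts [he.eval_lt, hs.2 a']
  | seq p q s s₁ s₂ t₁ t₂ _ _ ihp ihq => exact fun hs => ihq (ihp hs)
  | branch_true b p q s s₁ t _ _ _ ih => exact ih
  | branch_false b p q s s₁ t _ _ _ ih => exact ih
  | loop_true b p s s₁ s₂ t₁ t₂ _ _ _ _ ihp ihl => exact fun hs => ihl (ihp hs)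
  | loop_false => exact id

/-- Weakest precondition: started in `s`, the program `p` halts within the time that its loops need
when each is run through at most `n` times, and the final state satisfies `Q`. -/
def WP (W n : ℕ) (p : Program) (s : State) (Q : State → Prop) : Prop :=
  ∃ t s', Exec W p s t s' ∧ t ≤ p.time n ∧ Q s'

namespace WP

variable {W n : ℕ} {s : State} {Q Q' : State → Prop}

theorem mono {p : Program} (h : WP W n p s Q') (hQ : ∀ s', Q' s' → Q s') : WP W n p s Q := by
  obtain ⟨t, s', h1, h2, h3⟩ := h
  exact ⟨t, s', h1, h2, hQ s' h3⟩

theorem skip (h : Q s) : WP W n Program.skip s Q :=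
  ⟨_, _, Exec.skip s, le_rfl, h⟩

theorem assign {r : ℕ} {e : Exp} (hs : s.Ok W n) (hr : r ≠ 0) (he : e.Fits W s)
    (h : (s.set r (e.eval s)).Ok W n → Q (s.set r (e.eval s))) :
    WP W n (Program.assign r e) s Q :=
  ⟨_, _, Exec.assign r e s he, le_rfl, h (hs.set hr he.eval_lt)⟩

theorem store {a e : Exp} (hs : s.Ok W n) (ha : a.Fits W s) (he : e.Fits W s)
    (h : (s.put (a.eval s) (e.eval s)).Ok W n → Q (s.put (a.eval s) (e.eval s))) :
    WP W n (Program.store a e) s Q :=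
  ⟨_, _, Exec.store a e s ha he, le_rfl, h (hs.put he.eval_lt)⟩

theorem seq {p q : Program} (h : WP W n p s fun s' => WP W n q s' Q) :
    WP W n (Program.seq p q) s Q := by
  obtain ⟨t, s', h1, h2, t', s'', h3, h4, h5⟩ := h
  exact ⟨_, _, Exec.seq p q _ _ _ _ _ h1 h3, by simp only [Program.time]; omega, h5⟩

theorem branch {b : Test} {p q : Program} (hb : b.Fits W s) (hp : b.Holds s → WP W n p s Q)
    (hq : ¬ b.Holds s → WP W n q s Q) : WP W n (Program.branch b p q) s Q := by
  by_cases h : b.Holds s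
  · obtain ⟨t, s', h1, h2, h3⟩ := hp h
    exact ⟨_, _, Exec.branch_true b p q _ _ _ hb h h1, by simp only [Program.time]; omega, h3⟩
  · obtain ⟨t, s', h1, h2, h3⟩ := hq h
    exact ⟨_, _, Exec.branch_false b p q _ _ _ hb h h1, by simp only [Program.time]; omega, h3⟩

/-- The invariant rule for `for` loops. -/
theorem forLoop {r : ℕ} {p : Program} (Inv : ℕ → State → Prop) (hs : s.Ok W n)
    (hr : r ∉ p.writes) (h0 : 0 ∉ r :: p.writes) (hW : 1 < W)
    (init : Inv 0 (s.set r 0))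
    (step : ∀ i < n, ∀ s' : State, s'.Ok W n → (∀ x, x ∉ r :: p.writes → s'.reg x = s.reg x) →
      s'.reg r = i → Inv i s' → WP W n p s' fun s'' => Inv (i + 1) (s''.set r (i + 1)))
    (post : ∀ s' : State, s'.Ok W n → (∀ x, x ∉ r :: p.writes → s'.reg x = s.reg x) →
      Inv n s' → Q s') :
    WP W n (Program.forLoop r p) s Q := by
  have hr0 : r ≠ 0 := fun h => h0 (by simp [h])
  have h0p : 0 ∉ p.writes := fun h => h0 (List.mem_cons_of_mem _ h)
  -- The loop, entered with `k` rounds left, needs the time of `k` rounds and of one final test.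
  have main : ∀ k i : ℕ, i + k = n → ∀ s' : State, s'.Ok W n →
      (∀ x, x ∉ r :: p.writes → s'.reg x = s.reg x) → s'.reg r = i → Inv i s' →
      ∃ t s'', Exec W (Program.loop (Test.lt (Exp.reg r) (Exp.reg 0))
          (Program.seq p (Program.assign r (Exp.add (Exp.reg r) (Exp.const 1))))) s' t s'' ∧
        t ≤ k * (3 + 1 + (p.time n + 4)) + (3 + 1) ∧ Q s'' := by
    intro k
    induction k with
    | zero =>
      intro i hi s' ok fr hri hinv
      refine ⟨_, _, Exec.loop_false _ _ s' ⟨ok.reg_lt _, ok.reg_lt _⟩ ?_, ?_, ?_⟩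
      · simp only [Test.Holds, Exp.eval, hri, ok.reg_zero]
        omega
      · simp [Test.cost, Exp.cost]
      · obtain rfl : i = n := by omega
        exact post s' ok fr hinv
    | succ k ih =>
      intro i hi s' ok fr hri hinv
      obtain ⟨t₁, s₁, e₁, ht₁, q₁⟩ := step i (by omega) s' ok fr hri hinv
      have hb := e₁.lt_bound ⟨ok.reg_lt, ok.mem_lt⟩
      have hri₁ : s₁.reg r = i := (e₁.reg_eq r hr).trans hri
      have hnW : n < W := by
        have := ok.reg_lt 0
        rwa [ok.reg_zero] at this
      have e₂ : Exec W (Program.assign r (Exp.add (Exp.reg r) (Exp.const 1))) s₁ 4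
          (s₁.set r (i + 1)) := by
        have := Exec.assign (W := W) r (Exp.add (Exp.reg r) (Exp.const 1)) s₁
          ⟨hb.1 r, hW, by simp only [Exp.eval, hri₁]; omega⟩
        simpa only [Exp.eval, hri₁, Exp.cost, State.set] using this
      have e₃ := Exec.seq _ _ _ _ _ _ _ e₁ e₂
      have hb' := e₃.lt_bound ⟨ok.reg_lt, ok.mem_lt⟩
      obtain ⟨t₃, s₃, e₄, ht₃, q₃⟩ := ih (i + 1) (by omega) (s₁.set r (i + 1))
        ⟨hb'.1, hb'.2, by
          simp [hr0.symm, e₁.reg_eq 0 h0p, ok.reg_zero]⟩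
        (fun x hx => by
          have hx' := hx
          simp only [List.mem_cons, not_or] at hx'
          rw [State.set_reg, if_neg hx'.1, e₁.reg_eq x hx'.2, fr x hx]) (by simp) q₁
      refine ⟨_, _, Exec.loop_true _ _ _ _ _ _ _ ⟨ok.reg_lt _, ok.reg_lt _⟩ ?_ e₃ e₄, ?_, q₃⟩
      · simp only [Test.Holds, Exp.eval, hri, ok.reg_zero]
        omega
      · simp only [Test.cost, Exp.cost, add_mul]
        omega
  obtain ⟨t, s', e, ht, q⟩ := main n 0 (by omega) (s.set r 0) (hs.set hr0 (by omega))
    (fun x hx => by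
      simp only [List.mem_cons, not_or] at hx
      simp [hx.1]) (by simp) init
  exact ⟨_, _, Exec.seq _ _ _ _ _ _ _
    (Exec.assign r (Exp.const 0) s (by simp only [Exp.Fits]; omega)) e,
    by
      have htime : (Program.forLoop r p).time n =
        2 + (n * (3 + 1 + (p.time n + 4)) + (3 + 1)) := rfl
      have hcost : (Exp.const 0).cost + 1 = 2 := rfl
      omega, q⟩

end WP

/-! ### The digraph of left endpoints -/

namespace ColoredArcs

variable {n : ℕ} (I : ColoredArcs n)

/-- Arc `i` contains the left endpoint of arc `j`. -/
def Hits (i j : Fin n) : Prop :=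
  (I.left i ≤ I.left j ∧ I.left j ≤ I.right i) ∨ I.left j + I.len ≤ I.right i

/-- The clockwise distance from the left endpoint of arc `u` to that of arc `i`. -/
def offset (u i : Fin n) : ℕ :=
  if I.left i < I.left u then I.left i + (I.len - I.left u) else I.left i - I.left u

variable {I}

theorem hits_of_int {i j : Fin n} {k : ℤ} (h1 : (I.left i : ℤ) ≤ I.left j + k * I.len)
    (h2 : (I.left j : ℤ) + k * I.len ≤ I.right i) : I.Hits i j := by
  have a1 := I.left_lt i
  have a2 := I.left_lt j
  have a3 := I.right_le i
  have hk0 : 0 ≤ k := by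
    by_contra h
    have : k * I.len ≤ (-1) * I.len := mul_le_mul_of_nonneg_right (by omega) (by omega)
    omega
  have hk1 : k ≤ 1 := by
    by_contra h
    have : 2 * (I.len : ℤ) ≤ k * I.len := mul_le_mul_of_nonneg_right (by omega) (by omega)
    omega
  unfold Hits
  obtain rfl | rfl : k = 0 ∨ k = 1 := by omega
  all_goals omega

theorem Hits.exists_mem {i j : Fin n} (h : I.Hits i j) :
    (I.arc i ∩ I.arc j).Nonempty := by
  refine ⟨((I.left j : ℝ) : AddCircle (I.len : ℝ)), ?_, (I.left j : ℝ), ⟨le_rfl, ?_⟩, rfl⟩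
  · rcases h with h | h
    · exact ⟨I.left j, ⟨by exact_mod_cast h.1, by exact_mod_cast h.2⟩, rfl⟩
    · refine ⟨(I.left j : ℝ) + I.len, ⟨?_, by exact_mod_cast h⟩, ?_⟩
      · have := I.left_lt i
        exact_mod_cast (by omega : I.left i ≤ I.left j + I.len)
      · simp
  · exact_mod_cast I.left_le_right j

/-- Two arcs meet exactly when one of them contains the left endpoint of the other. -/
theorem graph_adj {i j : Fin n} : I.graph.Adj i j ↔ i ≠ j ∧ (I.Hits i j ∨ I.Hits j i) := by
  refine and_congr_right fun _ => ⟨?_, ?_⟩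
  · rintro ⟨x, ⟨a, ⟨ha1, ha2⟩, hax⟩, ⟨b, ⟨hb1, hb2⟩, hbx⟩⟩
    have hab : ((a : ℝ) : AddCircle (I.len : ℝ)) = b := hax.trans hbx.symm
    obtain ⟨k, hk⟩ := AddCircle.coe_eq_zero_iff _ |>.1
      (show ((a - b : ℝ) : AddCircle (I.len : ℝ)) = 0 by rw [AddCircle.coe_sub, hab, sub_self])
    rw [zsmul_eq_mul] at hk
    by_cases h : (I.left i : ℤ) ≤ I.left j + k * I.len
    · refine Or.inl (hits_of_int h ?_)
      have : (I.left j : ℝ) + k * I.len ≤ I.right i := by linarith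
      exact_mod_cast this
    · refine Or.inr (hits_of_int (k := -k) (by linarith) ?_)
      have : (I.left i : ℝ) + ((-k : ℤ) : ℝ) * I.len ≤ I.right j := by
        push_cast
        linarith
      exact_mod_cast this
  · rintro (h | h)
    · exact h.exists_mem
    · rw [Set.inter_comm]
      exact h.exists_mem

/-- Two arcs that contain the same left endpoint meet. -/
theorem Hits.comparable {i j k : Fin n} (hi : I.Hits i k) (hj : I.Hits j k) :
    I.Hits i j ∨ I.Hits j i := by
  have := I.left_lt i
  have := I.left_lt j
  have := I.left_lt k
  unfold Hits at *
  omega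

theorem offset_self (u : Fin n) : I.offset u u = 0 := by simp [offset]

/-- Walking clockwise from `u`, arc `v` covers all left endpoints between its own one and that of
an arc `w` that it hits. -/
theorem Hits.of_between {u v w i : Fin n} (h : I.Hits v w) (hv : I.offset u v < I.offset u i)
    (hw : I.offset u i ≤ I.offset u w) : I.Hits v i := by
  have := I.left_lt u
  have := I.left_lt v
  have := I.left_lt w
  have := I.left_lt i
  unfold Hits offset at *
  split_ifs at * <;> omega

theorem hits_of_offset_eq_zero {u i : Fin n} (h : I.offset u i = 0) : I.Hits u i := by
  have := I.left_lt u
  have := I.left_lt i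
  have := I.left_le_right u
  unfold Hits offset at *
  split_ifs at h <;> omega

variable (I) in
/-- There is a directed walk from `u` to `i` whose later vertices lie in `S`. -/
def Reach (S : Finset (Fin n)) (u i : Fin n) : Prop :=
  Relation.ReflTransGen (fun a b => I.Hits a b ∧ b ∈ S) u i

theorem Reach.mono {S S' : Finset (Fin n)} (h : S ⊆ S') {u i : Fin n} (hr : I.Reach S u i) :
    I.Reach S' u i :=
  Relation.ReflTransGen.mono (fun _ _ hab => ⟨hab.1, h hab.2⟩) _ _ hr

theorem Reach.mem {S : Finset (Fin n)} {u i : Fin n} (hr : I.Reach S u i) (hu : u ∈ S) :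
    i ∈ S := by
  rcases Relation.ReflTransGen.cases_tail hr with rfl | ⟨_, _, h⟩
  exacts [hu, h.2]

theorem preconnected_of_reach {S : Finset (Fin n)} {u : Fin n} (hu : u ∈ S)
    (h : ∀ i ∈ S, I.Reach S u i) : (I.graph.induce (S : Set (Fin n))).Preconnected := by
  have key : ∀ i, I.Reach S u i → ∀ hi : i ∈ S,
      (I.graph.induce (S : Set (Fin n))).Reachable ⟨u, hu⟩ ⟨i, hi⟩ := by
    intro i hi
    induction hi with
    | refl => exact fun _ => SimpleGraph.Reachable.refl _
    | @tail a b hab hb ih =>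
      intro hbS
      have haS : a ∈ S := Reach.mem hab hu
      by_cases hne : a = b
      · subst hne
        exact ih _
      · refine (ih haS).trans (SimpleGraph.Adj.reachable ?_)
        simpa using graph_adj.2 ⟨hne, Or.inl hb.1⟩
  intro a b
  exact (key _ (h a a.2) a.2).symm.trans (key _ (h b b.2) b.2)

/-- In-neighbours of a common vertex are comparable, so a vertex of a connected set with maximal
reach reaches the whole set. -/
theorem exists_root {S : Finset (Fin n)} (hne : S.Nonempty)
    (hS : (I.graph.induce (S : Set (Fin n))).Preconnected) :
    ∃ u ∈ S, ∀ i ∈ S, I.Reach S u i := by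
  classical
  obtain ⟨u, hu, hmax⟩ := S.exists_max_image (fun u => (S.filter fun i => I.Reach S u i).card) hne
  refine ⟨u, hu, fun i hi => ?_⟩
  -- A vertex hitting some vertex reached by `u` is reached by `u` itself.
  have back : ∀ x, I.Reach S u x → ∀ y ∈ S, I.Hits y x → I.Reach S u y := by
    intro x hx
    induction hx with
    | refl =>
      intro y hy hyu
      by_contra hn
      refine absurd (hmax y hy) (not_le.2 (Finset.card_lt_card ?_))
      refine Finset.ssubset_iff_of_subset (fun z hz => ?_) |>.2 ⟨y, ?_, ?_⟩
      · simp only [Finset.mem_filter] at hz ⊢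
        exact ⟨hz.1, Relation.ReflTransGen.head ⟨hyu, hu⟩ hz.2⟩
      · simp only [Finset.mem_filter]
        exact ⟨hy, Relation.ReflTransGen.refl⟩
      · simp [hn]
    | @tail a b hab hb ih =>
      intro y hy hyb
      rcases hb.1.comparable hyb with h | h
      · exact hab.tail ⟨h, hy⟩
      · exact ih y hy h
  have walk : ∀ x y : (S : Set (Fin n)), (I.graph.induce (S : Set (Fin n))).Reachable x y →
      I.Reach S u x → I.Reach S u y := by
    rintro x y ⟨w⟩
    induction w with
    | nil => exact id
    | cons hadj w ih =>
      intro hx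
      refine ih ?_
      have hadj' := (graph_adj.1 (SimpleGraph.induce_adj.1 hadj)).2
      rcases hadj' with h | h
      · exact Relation.ReflTransGen.tail hx ⟨h, Subtype.prop _⟩
      · exact back _ hx _ (Subtype.prop _) h
  exact walk ⟨u, hu⟩ ⟨i, hi⟩ (hS _ _) Relation.ReflTransGen.refl

/-- The last step of a walk that visits its final vertex only once. -/
theorem Reach.exists_pred {S : Finset (Fin n)} {u j : Fin n} (hr : I.Reach S u j) (hj : j ≠ u) :
    ∃ i, I.Reach (S.erase j) u i ∧ I.Hits i j := by
  have key : ∀ x, I.Reach S u x → (x ≠ j ∧ I.Reach (S.erase j) u x) ∨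
      ∃ i, I.Reach (S.erase j) u i ∧ I.Hits i j := by
    intro x hx
    induction hx with
    | refl => exact Or.inl ⟨hj.symm, Relation.ReflTransGen.refl⟩
    | @tail a b _ hb ih =>
      rcases ih with ⟨_, h⟩ | h
      · by_cases hbj : b = j
        · subst hbj
          exact Or.inr ⟨a, h, hb.1⟩
        · exact Or.inl ⟨hbj, Relation.ReflTransGen.tail h ⟨hb.1, Finset.mem_erase.2 ⟨hbj, hb.2⟩⟩⟩
      · exact Or.inr h
  rcases key j hr with h | h
  exacts [absurd rfl h.1, h]

variable (I) in
/-- `S` contains a walk from `u` to `j`; it is connected and meets every arc that starts between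
`u` and `j`. -/
structure Spans (u j : Fin n) (S : Finset (Fin n)) : Prop where
  root_mem : u ∈ S
  end_mem : j ∈ S
  reach : ∀ i ∈ S, I.Reach S u i
  dominates : ∀ i, I.offset u i ≤ I.offset u j → ∃ k ∈ S, I.Hits k i

theorem spans_singleton (u : Fin n) : I.Spans u u {u} where
  root_mem := by simp
  end_mem := by simp
  reach i hi := by
    rw [Finset.mem_singleton.1 hi]
    exact Relation.ReflTransGen.refl
  dominates i hi := ⟨u, by simp, hits_of_offset_eq_zero (by rw [offset_self] at hi; omega)⟩

theorem Spans.insert {u i j : Fin n} {S : Finset (Fin n)} (h : I.Spans u i S) (hij : I.Hits i j) :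
    I.Spans u j (insert j S) where
  root_mem := Finset.mem_insert_of_mem h.root_mem
  end_mem := Finset.mem_insert_self _ _
  reach k hk := by
    have hm := fun k hk => (h.reach k hk).mono (Finset.subset_insert j S)
    rcases Finset.mem_insert.1 hk with rfl | hk
    · exact (hm i h.end_mem).tail ⟨hij, Finset.mem_insert_self _ _⟩
    · exact hm k hk
  dominates k hk := by
    by_cases hki : I.offset u k ≤ I.offset u i
    · obtain ⟨x, hx, hxk⟩ := h.dominates k hki
      exact ⟨x, Finset.mem_insert_of_mem hx, hxk⟩
    · exact ⟨i, Finset.mem_insert_of_mem h.end_mem, hij.of_between (by omega) hk⟩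

/-- A spanning set stays connected when arcs starting between its ends are added. -/
theorem Spans.preconnected {u v : Fin n} {S H : Finset (Fin n)} (h : I.Spans u v S) (hSH : S ⊆ H)
    (hH : ∀ i ∈ H, I.offset u i ≤ I.offset u v) :
    (I.graph.induce (H : Set (Fin n))).Preconnected := by
  refine preconnected_of_reach (hSH h.root_mem) fun i hi => ?_
  obtain ⟨k, hk, hki⟩ := h.dominates i (hH i hi)
  exact ((h.reach k hk).mono hSH).tail ⟨hki, hi⟩

/-! ### Counting colors -/

variable (I) in
/-- The word encoding the color of an arc. -/
def colorWord (i : Fin n) : ℕ := if I.color i = Color.red then 1 else 0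

variable (I) in
/-- The number of arcs in `S` whose color word is `c`. -/
def same (c : ℕ) (S : Finset (Fin n)) : ℕ := (S.filter fun i => I.colorWord i = c).card

variable (I) in
/-- The number of arcs in `S` whose color word is not `c`. -/
def diff (c : ℕ) (S : Finset (Fin n)) : ℕ := (S.filter fun i => I.colorWord i ≠ c).card

variable (I) in
/-- The arcs that start between `u` and `v`. -/
def window (u v : Fin n) : Finset (Fin n) :=
  Finset.univ.filter fun i => I.offset u i ≤ I.offset u v

theorem mem_window {u v i : Fin n} : i ∈ I.window u v ↔ I.offset u i ≤ I.offset u v := by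
  simp [window]

theorem same_mono {c : ℕ} {S T : Finset (Fin n)} (h : S ⊆ T) : I.same c S ≤ I.same c T :=
  Finset.card_le_card (Finset.filter_subset_filter _ h)

theorem diff_mono {c : ℕ} {S T : Finset (Fin n)} (h : S ⊆ T) : I.diff c S ≤ I.diff c T :=
  Finset.card_le_card (Finset.filter_subset_filter _ h)

theorem same_add_diff (c : ℕ) (S : Finset (Fin n)) : I.same c S + I.diff c S = S.card :=
  Finset.card_filter_add_card_filter_not (s := S) (fun i => I.colorWord i = c)

theorem same_insert_of_notMem {c : ℕ} {S : Finset (Fin n)} {j : Fin n} (h : j ∉ S) :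
    I.same c (insert j S) = I.same c S + if I.colorWord j = c then 1 else 0 := by
  unfold same
  rw [Finset.filter_insert]
  split_ifs
  · rw [Finset.card_insert_of_notMem (by simp [h])]
  · simp

theorem same_insert_le (c : ℕ) (S : Finset (Fin n)) (j : Fin n) :
    I.same c (insert j S) ≤ I.same c S + if I.colorWord j = c then 1 else 0 := by
  by_cases h : j ∈ S
  · rw [Finset.insert_eq_of_mem h]
    omega
  · exact (same_insert_of_notMem h).le

theorem isBalanced_iff {c : ℕ} (hc : c = 0 ∨ c = 1) {H : Finset (Fin n)} :
    IsBalanced I.color H ↔ I.same c H = I.diff c H := by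
  have h1 : ∀ i, I.color i = Color.blue ↔ ¬ I.color i = Color.red := fun i => by
    cases I.color i <;> simp
  unfold IsBalanced same diff colorWord
  rcases hc with rfl | rfl
  · simp [h1, eq_comm]
  · simp [h1]

variable (I) in
/-- The window from `u` to `v` contains a balanced set with `m` arcs of each color: `c` is a
majority color of the window, `m` is the number of other arcs, and `u` and `v` are joined inside
the window by a walk with at most `m` arcs of color `c`. -/
structure Candidate (u v : Fin n) (c m : ℕ) : Prop where
  majority : I.diff c (I.window u v) ≤ I.same c (I.window u v)
  eq : m = I.diff c (I.window u v)
  walk : ∃ S ⊆ I.window u v, u ∈ S ∧ v ∈ S ∧ I.Reach S u v ∧ I.same c S ≤ m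

/-- No balanced connected set is larger than the best candidate. -/
theorem exists_candidate {H : Finset (Fin n)} (hne : H.Nonempty)
    (hH : IsBalancedConnected I.graph I.color H) :
    ∃ u v c m, (c = 0 ∨ c = 1) ∧ I.Candidate u v c m ∧ H.card ≤ 2 * m := by
  obtain ⟨u, hu, hr⟩ := exists_root hne hH.1
  obtain ⟨v, hv, hmax⟩ := H.exists_max_image (I.offset u) hne
  have hsub : H ⊆ I.window u v := fun i hi => mem_window.2 (hmax i hi)
  obtain ⟨c, hc, hmaj⟩ : ∃ c, (c = 0 ∨ c = 1) ∧
      I.diff c (I.window u v) ≤ I.same c (I.window u v) := by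
    have h : I.same 1 (I.window u v) = I.diff 0 (I.window u v) := by
      unfold same diff colorWord
      congr 2
      ext
      split_ifs <;> simp
    have h0 := I.same_add_diff 0 (I.window u v)
    have h1 := I.same_add_diff 1 (I.window u v)
    by_cases hle : I.diff 0 (I.window u v) ≤ I.same 0 (I.window u v)
    · exact ⟨0, Or.inl rfl, hle⟩
    · exact ⟨1, Or.inr rfl, by omega⟩
  have hb := (isBalanced_iff hc).1 hH.2
  have hd := diff_mono (I := I) (c := c) hsub
  have hcard := I.same_add_diff c H
  exact ⟨u, v, c, _, hc, ⟨hmaj, rfl, H, hsub, hu, hv, hr v hv, by omega⟩, by omega⟩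

end ColoredArcs

/-! ### Arrays in memory -/

/-- The address of entry `i` of the `k`-th array of length `n` behind the input; array `0` is the
output. -/
def addr (n k i : ℕ) : ℕ := 2 + n * (k + 3) + i

theorem addr_inj {n k k' i i' : ℕ} (hi : i < n) (hi' : i' < n) :
    addr n k i = addr n k' i' ↔ k = k' ∧ i = i' := by
  refine ⟨fun h => ?_, fun h => by rw [h.1, h.2]⟩
  unfold addr at h
  rcases lt_trichotomy k k' with hk | rfl | hk
  · have := Nat.mul_le_mul_left n (show k + 3 + 1 ≤ k' + 3 by omega)
    rw [mul_add, mul_one] at this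
    omega
  · exact ⟨rfl, by omega⟩
  · have := Nat.mul_le_mul_left n (show k' + 3 + 1 ≤ k + 3 by omega)
    rw [mul_add, mul_one] at this
    omega

/-- Entry `i` of the `k`-th array. -/
def State.arr (s : State) (n k i : ℕ) : ℕ := s.mem (addr n k i)

/-- The memory cells of `s'` and `s` agree on the input and on all arrays with index in `K`. -/
structure State.Agree (n : ℕ) (K : ℕ → Prop) (s s' : State) : Prop where
  input : ∀ a < 2 + 3 * n, s'.mem a = s.mem a
  arr : ∀ k, K k → ∀ i : Fin n, s'.arr n k i = s.arr n k i

namespace State.Agree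

variable {n : ℕ} {K K' : ℕ → Prop} {s s' s'' : State}

theorem refl (n : ℕ) (K : ℕ → Prop) (s : State) : s.Agree n K s :=
  ⟨fun _ _ => rfl, fun _ _ _ => rfl⟩

theorem trans (h : s.Agree n K s') (h' : s'.Agree n K s'') : s.Agree n K s'' :=
  ⟨fun a ha => (h'.input a ha).trans (h.input a ha),
    fun k hk i => (h'.arr k hk i).trans (h.arr k hk i)⟩

theorem mono (h : s.Agree n K s') (hK : ∀ k, K' k → K k) : s.Agree n K' s' :=
  ⟨h.input, fun k hk => h.arr k (hK k hk)⟩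

end State.Agree

theorem State.agree_put (s : State) {n k : ℕ} (i : Fin n) (x : ℕ) :
    s.Agree n (· ≠ k) (s.put (addr n k i) x) := by
  refine ⟨fun a ha => ?_, fun k' hk j => ?_⟩
  · have : n * 3 ≤ n * (k + 3) := Nat.mul_le_mul_left n (by omega)
    rw [State.put_mem, if_neg]
    unfold addr
    omega
  · rw [State.arr, State.put_mem, if_neg, State.arr]
    rw [addr_inj j.2 i.2]
    exact fun h => hk h.1

theorem State.arr_put (s : State) {n k : ℕ} (i j : Fin n) (x : ℕ) :
    (s.put (addr n k i) x).arr n k j = if j = i then x else s.arr n k j := by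
  simp only [State.arr, State.put_mem, addr_inj j.2 i.2, true_and, Fin.ext_iff]

@[simp] theorem State.arr_set (s : State) (n r v k i : ℕ) :
    (s.set r v).arr n k i = s.arr n k i := rfl

theorem State.Agree.set {n : ℕ} {K : ℕ → Prop} {s s' : State} (h : s.Agree n K s') (r v : ℕ) :
    s.Agree n K (s'.set r v) := ⟨h.input, h.arr⟩

@[simp] theorem State.output_set (s : State) (n r v : ℕ) : (s.set r v).output n = s.output n := rfl

theorem State.mem_output {s : State} {n : ℕ} {i : Fin n} : i ∈ s.output n ↔ s.arr n 0 i = 1 := by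
  simp only [State.output, Finset.mem_filter, Finset.mem_univ, true_and, State.arr, addr, zero_add,
    mul_comm]

/-- The memory of `s` contains the input `I`. -/
structure State.HasInput {n : ℕ} (s : State) (I : ColoredArcs n) : Prop where
  len : s.mem 1 = I.len
  left : ∀ i : Fin n, s.mem (2 + 3 * i) = I.left i
  right : ∀ i : Fin n, s.mem (3 + 3 * i) = I.right i
  color : ∀ i : Fin n, s.mem (4 + 3 * i) = I.colorWord i

theorem State.HasInput.of_agree {n : ℕ} {I : ColoredArcs n} {s s' : State} {K : ℕ → Prop}
    (h : s.HasInput I) (ha : s.Agree n K s') : s'.HasInput I where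
  len := (ha.input _ (by omega)).trans h.len
  left i := (ha.input _ (by omega)).trans (h.left i)
  right i := (ha.input _ (by omega)).trans (h.right i)
  color i := (ha.input _ (by omega)).trans (h.color i)

/-! ### Expressions and tests for the input and the arrays -/

namespace Exp

/-- The left endpoint of arc `e`. -/
def left (e : Exp) : Exp := load (add (const 2) (mul (const 3) e))

/-- The right endpoint of arc `e`. -/
def right (e : Exp) : Exp := load (add (const 3) (mul (const 3) e))

/-- The color word of arc `e`. -/
def color (e : Exp) : Exp := load (add (const 4) (mul (const 3) e))

/-- The address of entry `e` of array `k`, where register `0` holds `n`. -/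
def cell (k e : Exp) : Exp := add (add (const 2) (mul (reg 0) (add k (const 3)))) e

/-- `1` if arc `e` has the color in register `4`, and `0` otherwise. -/
def weight (e : Exp) : Exp :=
  sub (const 1) (add (sub (color e) (reg 4)) (sub (reg 4) (color e)))

end Exp

namespace Test

/-- Arc `a` contains the left endpoint of arc `b`. Lengths are compared in the form
`len ≤ right a - left b`, as `left b + len` might be too large for a word. -/
def hits (a b : Exp) : Test :=
  not (and (not (and (not (lt b.left a.left)) (not (lt a.right b.left))))
    (lt (Exp.sub a.right b.left) (Exp.load (Exp.const 1))))

/-- Arc `e` starts between the arcs in registers `2` and `3`; array `1` holds the offsets. -/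
def inWindow (e : Exp) : Test :=
  not (lt (Exp.load (Exp.cell (Exp.const 1) (Exp.reg 3)))
    (Exp.load (Exp.cell (Exp.const 1) e)))

end Test

section

variable {W n : ℕ} {s : State}

theorem cube_bounds (hW : (n + 2) ^ 3 ≤ W) : 8 + 12 * n ≤ W := by
  have : (n + 2) ^ 3 = n * n * n + 6 * (n * n) + 12 * n + 8 := by ring
  omega

theorem Exp.input_fits (ok : s.Ok W n) (hW : (n + 2) ^ 3 ≤ W) {e : Exp} (he : e.Fits W s)
    (hn : e.eval s < n) {c : ℕ} (hc : c ≤ 4) :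
    (Exp.load (Exp.add (Exp.const c) (Exp.mul (Exp.const 3) e))).Fits W s := by
  have := cube_bounds hW
  simp only [Exp.Fits, Exp.eval]
  exact ⟨⟨by omega, ⟨by omega, he, by omega⟩, by omega⟩, ok.mem_lt _⟩

theorem Exp.left_fits (ok : s.Ok W n) (hW : (n + 2) ^ 3 ≤ W) {e : Exp} (he : e.Fits W s)
    (hn : e.eval s < n) : e.left.Fits W s := Exp.input_fits ok hW he hn (by omega)

theorem Exp.right_fits (ok : s.Ok W n) (hW : (n + 2) ^ 3 ≤ W) {e : Exp} (he : e.Fits W s)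
    (hn : e.eval s < n) : e.right.Fits W s := Exp.input_fits ok hW he hn (by omega)

theorem Exp.color_fits (ok : s.Ok W n) (hW : (n + 2) ^ 3 ≤ W) {e : Exp} (he : e.Fits W s)
    (hn : e.eval s < n) : e.color.Fits W s := Exp.input_fits ok hW he hn (by omega)

theorem Exp.cell_fits (ok : s.Ok W n) (hW : (n + 2) ^ 3 ≤ W) {k e : Exp} (hk : k.Fits W s)
    (hkn : k.eval s ≤ n + 2) (he : e.Fits W s) (hn : e.eval s < n) :
    (Exp.cell k e).Fits W s := by
  have h1 : (n + 2) ^ 3 = n * n * n + 6 * (n * n) + 12 * n + 8 := by ring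
  have h2 : n * (k.eval s + 3) ≤ n * n + 5 * n :=
    (Nat.mul_le_mul_left n (show k.eval s + 3 ≤ n + 5 by omega)).trans (by rw [mul_add]; omega)
  simp only [Exp.cell, Exp.Fits, Exp.eval, ok.reg_zero]
  exact ⟨⟨by omega, ⟨by omega, ⟨hk, by omega, by omega⟩, by omega⟩, by omega⟩, he, by omega⟩

theorem Exp.cell_eval (ok : s.Ok W n) (k e : Exp) :
    (Exp.cell k e).eval s = addr n (k.eval s) (e.eval s) := by
  simp only [Exp.cell, Exp.eval, ok.reg_zero, addr]

theorem Exp.entry_fits (ok : s.Ok W n) (hW : (n + 2) ^ 3 ≤ W) {k e : Exp} (hk : k.Fits W s)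
    (hkn : k.eval s ≤ n + 2) (he : e.Fits W s) (hn : e.eval s < n) :
    (Exp.load (Exp.cell k e)).Fits W s :=
  ⟨Exp.cell_fits ok hW hk hkn he hn, ok.mem_lt _⟩

theorem Exp.entry_eval (ok : s.Ok W n) (k e : Exp) :
    (Exp.load (Exp.cell k e)).eval s = s.arr n (k.eval s) (e.eval s) := by
  rw [Exp.eval, Exp.cell_eval ok, State.arr]

theorem Exp.weight_fits (ok : s.Ok W n) (hW : (n + 2) ^ 3 ≤ W) {e : Exp} (he : e.Fits W s)
    (hn : e.eval s < n) : e.weight.Fits W s := by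
  have h1 := cube_bounds hW
  have h2 := Exp.color_fits ok hW he hn
  have h3 := h2.eval_lt
  have h4 := ok.reg_lt 4
  simp only [Exp.weight, Exp.Fits, Exp.eval]
  exact ⟨by omega, ⟨⟨h2, h4, by omega⟩, ⟨h4, h2, by omega⟩, by omega⟩, by omega⟩

variable {I : ColoredArcs n}

theorem Exp.weight_eval (inp : s.HasInput I) {e : Exp} {i : Fin n} (he : e.eval s = i) :
    e.weight.eval s = if I.colorWord i = s.reg 4 then 1 else 0 := by
  simp only [Exp.weight, Exp.color, Exp.eval, he, inp.color]
  split_ifs <;> omega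

theorem Test.hits_fits (ok : s.Ok W n) (hW : (n + 2) ^ 3 ≤ W) {a b : Exp} (ha : a.Fits W s)
    (han : a.eval s < n) (hb : b.Fits W s) (hbn : b.eval s < n) : (Test.hits a b).Fits W s := by
  have h1 := cube_bounds hW
  have h2 := Exp.left_fits ok hW ha han
  have h3 := Exp.left_fits ok hW hb hbn
  have h4 := Exp.right_fits ok hW ha han
  have h5 := h4.eval_lt
  simp only [Test.hits, Test.Fits, Exp.Fits]
  exact ⟨⟨⟨h3, h2⟩, h4, h3⟩, ⟨h4, h3, by omega⟩, by omega, ok.mem_lt _⟩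

theorem Test.hits_holds (inp : s.HasInput I) {a b : Exp} {i j : Fin n} (ha : a.eval s = i)
    (hb : b.eval s = j) : (Test.hits a b).Holds s ↔ I.Hits i j := by
  simp only [Test.hits, Test.Holds, Exp.left, Exp.right, Exp.eval, ha, hb, inp.left, inp.right,
    inp.len, ColoredArcs.Hits]
  have := I.len_pos
  omega

/-- The state in the part of the program that deals with the window from `u` to `v` and with the
color `c`. -/
structure Ctx (I : ColoredArcs n) (W : ℕ) (u v : Fin n) (c : ℕ) (s : State) : Prop where
  ok : s.Ok W n
  inp : s.HasInput I
  offset : ∀ x : Fin n, s.arr n 1 x = I.offset u x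
  reg_u : s.reg 2 = u
  reg_v : s.reg 3 = v
  reg_c : s.reg 4 = c

variable {u v : Fin n} {c : ℕ}

theorem Ctx.of_agree {s' : State} (h : Ctx I W u v c s) (ok : s'.Ok W n) {K : ℕ → Prop}
    (ha : s.Agree n K s') (hK : K 1) (h2 : s'.reg 2 = s.reg 2) (h3 : s'.reg 3 = s.reg 3)
    (h4 : s'.reg 4 = s.reg 4) : Ctx I W u v c s' where
  ok := ok
  inp := h.inp.of_agree ha
  offset x := (ha.arr 1 hK x).trans (h.offset x)
  reg_u := h2.trans h.reg_u
  reg_v := h3.trans h.reg_v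
  reg_c := h4.trans h.reg_c

theorem Test.inWindow_fits (h : Ctx I W u v c s) (hW : (n + 2) ^ 3 ≤ W) {e : Exp} (he : e.Fits W s)
    (hn : e.eval s < n) : (Test.inWindow e).Fits W s := by
  have h1 := cube_bounds hW
  have hv : (Exp.reg 3).eval s < n := by simp only [Exp.eval, h.reg_v, v.2]
  have hk : (Exp.const 1).Fits W s := by simp only [Exp.Fits]; omega
  have hk' : (Exp.const 1).eval s ≤ n + 2 := by simp only [Exp.eval]; omega
  exact ⟨Exp.entry_fits h.ok hW hk hk' (h.ok.reg_lt 3) hv, Exp.entry_fits h.ok hW hk hk' he hn⟩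

theorem Test.inWindow_holds (h : Ctx I W u v c s) {e : Exp} {i : Fin n} (he : e.eval s = i) :
    (Test.inWindow e).Holds s ↔ i ∈ I.window u v := by
  simp only [Test.inWindow, Test.Holds, Exp.entry_eval h.ok, he, ColoredArcs.mem_window]
  simp only [Exp.eval, h.reg_v, h.offset, not_lt]

/-- A loop that computes array `k`. -/
theorem WP.fillArray {r : ℕ} {p : Program} {Q : State → Prop} (k : ℕ) (f : Fin n → ℕ)
    (ok : s.Ok W n) (hr : r ∉ p.writes) (h0 : 0 ∉ r :: p.writes) (hW : 1 < W)
    (step : ∀ i : Fin n, ∀ s' : State, s'.Ok W n →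
      (∀ x, x ∉ r :: p.writes → s'.reg x = s.reg x) → s'.reg r = i → s.Agree n (· ≠ k) s' →
      WP W n p s' fun s'' => s''.mem = (s'.put (addr n k i) (f i)).mem)
    (post : ∀ s' : State, s'.Ok W n → (∀ x, x ∉ r :: p.writes → s'.reg x = s.reg x) →
      s.Agree n (· ≠ k) s' → (∀ i : Fin n, s'.arr n k i = f i) → Q s') :
    WP W n (Program.forLoop r p) s Q := by
  refine WP.forLoop (fun i s' => s.Agree n (· ≠ k) s' ∧ ∀ x : Fin n, x.val < i → s'.arr n k x = f x)
    ok hr h0 hW ⟨⟨fun _ _ => rfl, fun _ _ _ => rfl⟩, fun x hx => absurd hx (Nat.not_lt_zero _)⟩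
    ?_ (fun s' ok' fr h => post s' ok' fr h.1 fun i => h.2 i i.2)
  intro i hi s' ok' fr hri ⟨hag, hf⟩
  refine (step ⟨i, hi⟩ s' ok' fr hri hag).mono fun s'' hs'' => ?_
  have hm : ∀ k' x, (s''.set r (i + 1)).arr n k' x =
      (s'.put (addr n k (⟨i, hi⟩ : Fin n)) (f ⟨i, hi⟩)).arr n k' x := fun k' x => by
    simp only [State.arr, State.set_mem, hs'']
  have hp := s'.agree_put (k := k) ⟨i, hi⟩ (f ⟨i, hi⟩)
  refine ⟨hag.trans ⟨fun a ha => ?_, fun k' hk x => ?_⟩, fun x hx => ?_⟩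
  · rw [State.set_mem, hs'', hp.input a ha]
  · rw [hm, hp.arr k' hk x]
  · rw [hm, State.arr_put]
    split_ifs with hxi
    · rw [hxi]
    · refine hf x ?_
      have : x.val ≠ i := fun h => hxi (Fin.ext h)
      omega

/-- Extending a count over an initial segment by one element. -/
theorem card_filter_lt_succ (p : Fin n → Prop) [DecidablePred p] (i : Fin n) :
    (Finset.univ.filter fun x : Fin n => x.val < i + 1 ∧ p x).card =
      (Finset.univ.filter fun x : Fin n => x.val < i ∧ p x).card + if p i then 1 else 0 := by
  have : (Finset.univ.filter fun x : Fin n => x.val < i + 1 ∧ p x) =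
      if p i then insert i (Finset.univ.filter fun x : Fin n => x.val < i ∧ p x)
      else Finset.univ.filter fun x : Fin n => x.val < i ∧ p x := by
    ext x
    have h1 : x.val < i + 1 ↔ x.val < i ∨ x = i := by rw [Fin.ext_iff]; omega
    split_ifs with hp
    · simp only [Finset.mem_filter, Finset.mem_univ, true_and, Finset.mem_insert, h1]
      constructor
      · rintro ⟨h | h, h'⟩
        exacts [Or.inr ⟨h, h'⟩, Or.inl h]
      · rintro (h | h)
        exacts [⟨Or.inr h, h ▸ hp⟩, ⟨Or.inl h.1, h.2⟩]
    · simp only [Finset.mem_filter, Finset.mem_univ, true_and, h1]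
      constructor
      · rintro ⟨h | h, h'⟩
        exacts [⟨h, h'⟩, absurd (h ▸ h') hp]
      · exact fun h => ⟨Or.inl h.1, h.2⟩
  rw [this]
  split_ifs
  · exact Finset.card_insert_of_notMem (by simp)
  · rfl

end

/-! ### The program -/

namespace Program

/-- Computes the offsets of all arcs from the arc in register `2` into array `1`. -/
def offsets : Program :=
  forLoop 8 (branch (Test.lt (Exp.reg 8).left (Exp.reg 2).left)
    (store (Exp.cell (Exp.const 1) (Exp.reg 8))
      (Exp.add (Exp.reg 8).left (Exp.sub (Exp.load (Exp.const 1)) (Exp.reg 2).left)))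
    (store (Exp.cell (Exp.const 1) (Exp.reg 8)) (Exp.sub (Exp.reg 8).left (Exp.reg 2).left)))

/-- Counts the arcs of the window with the color in register `4` in register `9`, and its other
arcs in register `10`. -/
def count : Program :=
  seq (assign 9 (Exp.const 0)) (seq (assign 10 (Exp.const 0))
    (forLoop 8 (branch (Test.inWindow (Exp.reg 8))
      (seq (assign 9 (Exp.add (Exp.reg 9) (Exp.reg 8).weight))
        (assign 10 (Exp.add (Exp.reg 10) (Exp.sub (Exp.const 1) (Exp.reg 8).weight))))
      skip)))

/-- The address of the entry of array `2` for arc `e`, which holds the length of the best known walk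
to `e`; only arcs with the color in register `4` contribute to the length. -/
def dist (e : Exp) : Exp := Exp.cell (Exp.const 2) e

/-- The address of entry `x` of the array that marks the vertices of the best known walk to arc `e`. -/
def row (e x : Exp) : Exp := Exp.cell (Exp.add e (Exp.const 3)) x

/-- Only the walk that consists of the arc in register `2` is known; `n + 1` stands for an infinite
length. -/
def init : Program :=
  seq (forLoop 8 (store (dist (Exp.reg 8)) (Exp.add (Exp.reg 0) (Exp.const 1))))
    (seq (store (dist (Exp.reg 2)) (Exp.reg 2).weight)
      (seq (forLoop 8 (store (row (Exp.reg 2) (Exp.reg 8)) (Exp.const 0)))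
        (store (row (Exp.reg 2) (Exp.reg 2)) (Exp.const 1))))

/-- Tries to improve the walk to the arc in register `7` by one that comes from the arc in register
`6`. The vertex set of the improved walk is copied, so no predecessors have to be traced back. -/
def relax : Program :=
  branch (Test.and (Test.inWindow (Exp.reg 7)) (Test.and (Test.hits (Exp.reg 6) (Exp.reg 7))
      (Test.lt (Exp.add (Exp.load (dist (Exp.reg 6))) (Exp.reg 7).weight)
        (Exp.load (dist (Exp.reg 7))))))
    (seq (store (dist (Exp.reg 7)) (Exp.add (Exp.load (dist (Exp.reg 6))) (Exp.reg 7).weight))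
      (seq (forLoop 8 (store (row (Exp.reg 7) (Exp.reg 8))
          (Exp.load (row (Exp.reg 6) (Exp.reg 8)))))
        (store (row (Exp.reg 7) (Exp.reg 7)) (Exp.const 1))))
    skip

/-- The Bellman-Ford algorithm with `n` rounds. -/
def walks : Program := forLoop 5 (forLoop 6 (forLoop 7 relax))

/-- The address of entry `e` of the output. -/
def out (e : Exp) : Exp := Exp.cell (Exp.const 0) e

/-- Outputs the walk to the arc in register `3`. -/
def copyWalk : Program :=
  forLoop 8 (store (out (Exp.reg 8)) (Exp.load (row (Exp.reg 3) (Exp.reg 8))))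

/-- Counts the arcs in the output with the color in register `4` in register `12`. -/
def countOut : Program :=
  seq (assign 12 (Exp.const 0)) (forLoop 8
    (branch (Test.eq (Exp.load (out (Exp.reg 8))) (Exp.const 1))
      (assign 12 (Exp.add (Exp.reg 12) (Exp.reg 8).weight)) skip))

/-- Adds arcs of the window to the output: all that do not have the color in register `4`, and as
many arcs of that color as are needed to balance them. -/
def fill : Program :=
  forLoop 8 (branch (Test.and (Test.inWindow (Exp.reg 8))
      (Test.not (Test.eq (Exp.load (out (Exp.reg 8))) (Exp.const 1))))
    (branch (Test.eq (Exp.reg 8).weight (Exp.const 1))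
      (branch (Test.lt (Exp.reg 12) (Exp.reg 10))
        (seq (store (out (Exp.reg 8)) (Exp.const 1))
          (assign 12 (Exp.add (Exp.reg 12) (Exp.const 1))))
        skip)
      (store (out (Exp.reg 8)) (Exp.const 1)))
    skip)

/-- Replaces the output if the current window admits a larger one. Register `11` holds half the
size of the output. -/
def update : Program :=
  branch (Test.and (Test.not (Test.lt (Exp.reg 9) (Exp.reg 10)))
      (Test.and (Test.not (Test.lt (Exp.reg 10) (Exp.load (dist (Exp.reg 3)))))
        (Test.lt (Exp.reg 11) (Exp.reg 10))))
    (seq (assign 11 (Exp.reg 10)) (seq copyWalk (seq countOut fill)))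
    skip

/-- Treats the window between the arcs in registers `2` and `3` with the majority color in
register `4`. -/
def candidate : Program := seq count (seq init (seq walks update))

/-- The whole algorithm. Register `0` holds `n`; registers `2` and `3` hold the first and the last
arc `u`, `v` of the window and register `4` its majority color. Array `0` is the output, array `1`
holds the offsets from `u`, array `2` the lengths of the walks from `u`, and array `j + 3` marks the
vertices of the walk to `j`. -/
def main : Program :=
  seq (assign 0 (Exp.load (Exp.const 0)))
    (forLoop 2 (seq offsets (forLoop 3
      (seq (assign 4 (Exp.const 0)) (seq candidate
        (seq (assign 4 (Exp.const 1)) candidate))))))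

end Program

/-! ### Offsets, color counts and walks -/

section

variable {W n : ℕ} {s : State} {I : ColoredArcs n} {u v : Fin n} {c : ℕ} {Q : State → Prop}

theorem WP.offsets (ok : s.Ok W n) (hW : (n + 2) ^ 3 ≤ W) (inp : s.HasInput I) (hu : s.reg 2 = u)
    (post : ∀ s' : State, s'.Ok W n → (∀ x, x ∉ [8, 8] → s'.reg x = s.reg x) →
      s.Agree n (· ≠ 1) s' → (∀ i : Fin n, s'.arr n 1 i = I.offset u i) → Q s') :
    WP W n Program.offsets s Q := by
  have h1 := cube_bounds hW
  refine WP.fillArray 1 (fun i => I.offset u i) ok (by decide) (by decide) (by omega) ?_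
    (fun s' ok' fr => post s' ok' fun x hx => fr x ?_)
  swap
  · simpa [Program.writes] using hx
  intro i s' ok' fr hri hag
  have hu' : s'.reg 2 = u := (fr 2 (by decide)).trans hu
  have inp' := inp.of_agree hag
  have hu_n : (Exp.reg 2).eval s' < n := hu'.trans_lt u.2
  have hi_n : (Exp.reg 8).eval s' < n := hri.trans_lt i.2
  have fu := Exp.left_fits ok' hW (e := Exp.reg 2) (ok'.reg_lt 2) hu_n
  have fi := Exp.left_fits ok' hW (e := Exp.reg 8) (ok'.reg_lt 8) hi_n
  have eu : (Exp.reg 2).left.eval s' = I.left u := by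
    simp only [Exp.left, Exp.eval, hu', inp'.left]
  have ei : (Exp.reg 8).left.eval s' = I.left i := by
    simp only [Exp.left, Exp.eval, hri, inp'.left]
  have el : (Exp.load (Exp.const 1)).eval s' = I.len := by simp only [Exp.eval, inp'.len]
  have fl : (Exp.load (Exp.const 1)).Fits W s' := ⟨by simp only [Exp.Fits]; omega, ok'.mem_lt _⟩
  have fc : (Exp.cell (Exp.const 1) (Exp.reg 8)).Fits W s' :=
    Exp.cell_fits ok' hW (by simp only [Exp.Fits]; omega) (by simp only [Exp.eval]; omega)
      (ok'.reg_lt 8) hi_n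
  have ec : (Exp.cell (Exp.const 1) (Exp.reg 8)).eval s' = addr n 1 i := by
    rw [Exp.cell_eval ok']
    simp only [Exp.eval, hri]
  have hlenW : I.len < W := by
    have := ok'.mem_lt 1
    rwa [inp'.len] at this
  have hul := I.left_lt u
  have es : (Exp.sub (Exp.load (Exp.const 1)) (Exp.reg 2).left).eval s' = I.len - I.left u := by
    rw [Exp.eval, el, eu]
  refine WP.branch ⟨fi, fu⟩ ?_ ?_
  · intro h
    simp only [Test.Holds, eu, ei] at h
    have ea : (Exp.add (Exp.reg 8).left
        (Exp.sub (Exp.load (Exp.const 1)) (Exp.reg 2).left)).eval s' = I.offset u i := by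
      rw [Exp.eval, es, ei, ColoredArcs.offset, if_pos h]
    refine WP.store ok' fc ⟨fi, ⟨fl, fu, ?_⟩, ?_⟩ fun _ => ?_
    · rw [el, eu]
      omega
    · rw [es, ei]
      omega
    · rw [ec, ea]
  · intro h
    simp only [Test.Holds, eu, ei] at h
    have ea : (Exp.sub (Exp.reg 8).left (Exp.reg 2).left).eval s' = I.offset u i := by
      rw [Exp.eval, eu, ei, ColoredArcs.offset, if_neg h]
    refine WP.store ok' fc ⟨fi, fu, ?_⟩ fun _ => ?_
    · have := fi.eval_lt
      omega
    · rw [ec, ea]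

theorem WP.count (hs : Ctx I W u v c s) (hW : (n + 2) ^ 3 ≤ W)
    (post : ∀ s' : State, s'.Ok W n → (∀ x, x ∉ [8, 9, 10] → s'.reg x = s.reg x) →
      s'.mem = s.mem → s'.reg 9 = I.same c (I.window u v) → s'.reg 10 = I.diff c (I.window u v) →
      Q s') :
    WP W n Program.count s Q := by
  have h1 := cube_bounds hW
  have hz : (Exp.const 0).Fits W s := by simp only [Exp.Fits]; omega
  refine WP.seq (WP.assign hs.ok (by decide) hz fun ok₁ => ?_)
  refine WP.seq (WP.assign ok₁ (by decide) hz fun ok₂ => ?_)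
  refine WP.forLoop (fun i s' => s'.mem = s.mem ∧
    s'.reg 9 = (Finset.univ.filter fun x : Fin n =>
      x.val < i ∧ (x ∈ I.window u v ∧ I.colorWord x = c)).card ∧
    s'.reg 10 = (Finset.univ.filter fun x : Fin n =>
      x.val < i ∧ (x ∈ I.window u v ∧ I.colorWord x ≠ c)).card) ok₂ (by decide) (by decide)
    (by omega) ?_ ?_ ?_
  · simp [Exp.eval]
  · rintro i hi s' ok' fr hri ⟨hm, h9, h10⟩
    have fr' : ∀ x, x ∉ [8, 9, 10] → s'.reg x = s.reg x := fun x hx => by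
      have hx' : x ≠ 8 ∧ x ≠ 9 ∧ x ≠ 10 := by simpa using hx
      rw [fr x (by simpa [Program.writes] using hx')]
      simp [hx'.2.1, hx'.2.2]
    have ctx : Ctx I W u v c s' := hs.of_agree ok' (K := fun _ => True)
      ⟨fun a _ => by rw [hm], fun k _ x => by rw [State.arr, hm, State.arr]⟩ trivial
      (fr' 2 (by decide)) (fr' 3 (by decide)) (fr' 4 (by decide))
    have hin := card_filter_lt_succ (fun x => x ∈ I.window u v ∧ I.colorWord x = c) ⟨i, hi⟩
    have hin' := card_filter_lt_succ (fun x => x ∈ I.window u v ∧ I.colorWord x ≠ c) ⟨i, hi⟩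
    have hb : (Exp.reg 8).eval s' = (⟨i, hi⟩ : Fin n) := hri
    have hcard : ∀ p : Fin n → Prop, ∀ [DecidablePred p], (Finset.univ.filter p).card ≤ n :=
      fun p _ => (Finset.card_le_univ _).trans (Fintype.card_fin n).le
    have b9 : s'.reg 9 ≤ n := h9.trans_le (hcard _)
    have b10 : s'.reg 10 ≤ n := h10.trans_le (hcard _)
    have fw := Exp.weight_fits ok' hW (e := Exp.reg 8) (ok'.reg_lt 8) (hb.trans_lt hi)
    have ew := Exp.weight_eval ctx.inp hb
    rw [ctx.reg_c] at ew
    have ewle : (Exp.reg 8).weight.eval s' ≤ 1 := by rw [ew]; split_ifs <;> omega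
    refine WP.branch (Test.inWindow_fits ctx hW (ok'.reg_lt 8) (hb.trans_lt hi)) ?_ ?_
    · intro hwin
      rw [Test.inWindow_holds ctx hb] at hwin
      refine WP.seq (WP.assign ok' (by decide) ⟨ok'.reg_lt 9, fw, ?_⟩ fun ok'' => ?_)
      · simp only [Exp.eval] at *
        omega
      have fw' := Exp.weight_fits ok'' hW (e := Exp.reg 8) (ok''.reg_lt 8)
        (by simpa [Exp.eval] using hb.trans_lt hi)
      have ew' : ∀ x, (Exp.reg 8).weight.eval (s'.set 9 x) = (Exp.reg 8).weight.eval s' := by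
        simp [Exp.weight, Exp.color, Exp.eval]
      refine WP.assign ok'' (by decide)
        ⟨ok''.reg_lt 10, ⟨by simp only [Exp.Fits]; omega, fw', ?_⟩, ?_⟩ fun _ => ?_
      · simp only [Exp.eval]
        omega
      · simp only [Exp.eval, State.set_reg]
        simp only [Nat.reduceEqDiff, if_false]
        omega
      · refine ⟨hm, ?_, ?_⟩
        · rw [hin, ← h9]
          simp only [Exp.eval, State.set_reg, ew, hwin, true_and]
          simp
        · rw [hin', ← h10]
          simp only [Exp.eval, State.set_reg, ew', ew, hwin, true_and]
          by_cases hcw : I.colorWord ⟨i, hi⟩ = c <;> simp [hcw]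
    · intro hwin
      rw [Test.inWindow_holds ctx hb] at hwin
      refine WP.skip ⟨hm, ?_, ?_⟩
      · rw [hin, ← h9]
        simp [hwin]
      · rw [hin', ← h10]
        simp [hwin]
  · rintro s' ok' fr ⟨hm, h9, h10⟩
    refine post s' ok' (fun x hx => ?_) hm ?_ ?_
    · have hx' : x ≠ 8 ∧ x ≠ 9 ∧ x ≠ 10 := by simpa using hx
      rw [fr x (by simpa [Program.writes] using hx')]
      simp [hx'.2.1, hx'.2.2]
    · rw [h9, ColoredArcs.same]
      congr 1
      ext x
      simp
    · rw [h10, ColoredArcs.diff]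
      congr 1
      ext x
      simp

/-- The set marked by the `j`-th row. -/
def State.row (s : State) (n j : ℕ) : Finset (Fin n) :=
  Finset.univ.filter fun x : Fin n => s.arr n (j + 3) x = 1

/-- Every finite entry of the array of lengths belongs to a set of this weight or less that contains
a walk to the respective vertex. -/
def Sound (I : ColoredArcs n) (u v : Fin n) (c : ℕ) (s : State) : Prop :=
  ∀ j : Fin n, s.arr n 2 j ≤ n + 1 ∧ (s.arr n 2 j ≤ n →
    I.Spans u j (s.row n j) ∧ s.row n j ⊆ I.window u v ∧ I.same c (s.row n j) ≤ s.arr n 2 j)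

/-- No set of at most `k + 1` vertices of the window contains a walk from `u` and has smaller weight
than `f` records for the end of the walk. -/
def Lower (I : ColoredArcs n) (u v : Fin n) (c : ℕ) (k : ℕ) (f : Fin n → ℕ) : Prop :=
  ∀ S ⊆ I.window u v, S.card ≤ k + 1 → u ∈ S → ∀ j ∈ S, I.Reach S u j → f j ≤ I.same c S

/-- The weight of a vertex: `1` for color `c`, and `0` for the other color. -/
def ColoredArcs.wt (I : ColoredArcs n) (c : ℕ) (j : Fin n) : ℕ := if I.colorWord j = c then 1 else 0

/-- One round of the Bellman-Ford algorithm. -/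
theorem Lower.succ {k : ℕ} {f f' : Fin n → ℕ} (h : Lower I u v c k f) (hu : f u ≤ I.wt c u)
    (hle : ∀ j, f' j ≤ f j)
    (hrel : ∀ i j, I.Hits i j → j ∈ I.window u v → f' j ≤ f i + I.wt c j) :
    Lower I u v c (k + 1) f' := by
  intro S hS hcard huS j hj hr
  by_cases hju : j = u
  · subst hju
    have h1 : I.same c {j} ≤ I.same c S := ColoredArcs.same_mono (by simpa using huS)
    have h2 : I.wt c j = I.same c {j} := by
      rw [← insert_empty_eq, ColoredArcs.same_insert_of_notMem (by simp)]
      simp [ColoredArcs.wt, ColoredArcs.same]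
    have := hle j
    omega
  · obtain ⟨i, hi, hij⟩ := hr.exists_pred hju
    have huE : u ∈ S.erase j := Finset.mem_erase.2 ⟨fun h => hju h.symm, huS⟩
    have h1 := h (S.erase j) ((Finset.erase_subset _ _).trans hS)
      (by rw [Finset.card_erase_of_mem hj]; omega) huE i (hi.mem huE) hi
    have h2 := ColoredArcs.same_insert_of_notMem (I := I) (c := c) (Finset.notMem_erase j S)
    rw [Finset.insert_erase hj] at h2
    have h3 := hrel i j hij (hS hj)
    rw [h2]
    unfold ColoredArcs.wt at h3
    omega

theorem Lower.zero {f : Fin n → ℕ} (hu : f u ≤ I.wt c u) : Lower I u v c 0 f := by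
  intro S hS hcard huS j hj hr
  have hS1 : S = {u} := by
    obtain ⟨a, ha⟩ := Finset.card_eq_one.1
      (le_antisymm hcard (Finset.card_pos.2 ⟨u, huS⟩))
    subst ha
    rw [Finset.mem_singleton.1 huS]
  subst hS1
  rw [Finset.mem_singleton.1 hj]
  have h2 : I.wt c u = I.same c {u} := by
    rw [← insert_empty_eq, ColoredArcs.same_insert_of_notMem (by simp)]
    simp [ColoredArcs.wt, ColoredArcs.same]
  omega

theorem Exp.dist_fits (ok : s.Ok W n) (hW : (n + 2) ^ 3 ≤ W) {e : Exp} (he : e.Fits W s)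
    (hn : e.eval s < n) : (Program.dist e).Fits W s :=
  have := cube_bounds hW
  Exp.cell_fits ok hW (by simp only [Exp.Fits]; omega) (by simp only [Exp.eval]; omega) he hn

theorem Exp.dist_eval (ok : s.Ok W n) {e : Exp} {i : Fin n} (he : e.eval s = i) :
    (Program.dist e).eval s = addr n 2 i := by
  rw [Program.dist, Exp.cell_eval ok, he, Exp.eval]

theorem Exp.load_dist_eval (ok : s.Ok W n) {e : Exp} {i : Fin n} (he : e.eval s = i) :
    (Exp.load (Program.dist e)).eval s = s.arr n 2 i := by
  rw [Exp.eval, Exp.dist_eval ok he, State.arr]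

theorem Exp.row_fits (ok : s.Ok W n) (hW : (n + 2) ^ 3 ≤ W) {e x : Exp} (he : e.Fits W s)
    (hn : e.eval s < n) (hx : x.Fits W s) (hxn : x.eval s < n) : (Program.row e x).Fits W s :=
  have := cube_bounds hW
  Exp.cell_fits ok hW ⟨he, by simp only [Exp.Fits]; omega, by simp only [Exp.eval]; omega⟩
    (by simp only [Exp.eval]; omega) hx hxn

theorem Exp.row_eval (ok : s.Ok W n) {e x : Exp} {i j : Fin n} (he : e.eval s = i)
    (hx : x.eval s = j) : (Program.row e x).eval s = addr n (i + 3) j := by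
  rw [Program.row, Exp.cell_eval ok, hx]
  simp only [Exp.eval, he]

theorem Exp.out_fits (ok : s.Ok W n) (hW : (n + 2) ^ 3 ≤ W) {e : Exp} (he : e.Fits W s)
    (hn : e.eval s < n) : (Program.out e).Fits W s :=
  have := cube_bounds hW
  Exp.cell_fits ok hW (by simp only [Exp.Fits]; omega) (by simp only [Exp.eval]; omega) he hn

theorem Exp.out_eval (ok : s.Ok W n) {e : Exp} {i : Fin n} (he : e.eval s = i) :
    (Program.out e).eval s = addr n 0 i := by
  rw [Program.out, Exp.cell_eval ok, he, Exp.eval]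

/-- The arrays that the search for walks does not change. -/
def Fixed (k : ℕ) : Prop := k = 0 ∨ k = 1

theorem State.Agree.row_eq {K : ℕ → Prop} {s s' : State} (h : s.Agree n K s') {j : ℕ}
    (hK : K (j + 3)) : s'.row n j = s.row n j := by
  simp only [State.row, h.arr _ hK]

theorem WP.init (hs : Ctx I W u v c s) (hW : (n + 2) ^ 3 ≤ W)
    (post : ∀ s' : State, s'.Ok W n → (∀ x, x ≠ 8 → s'.reg x = s.reg x) →
      s.Agree n Fixed s' → Sound I u v c s' → s'.arr n 2 u ≤ I.wt c u → Q s') :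
    WP W n Program.init s Q := by
  have h1 := cube_bounds hW
  refine WP.seq (WP.fillArray 2 (fun _ => n + 1) hs.ok (by decide) (by decide) (by omega) ?_ ?_)
  · intro i s' ok' fr hri hag
    refine WP.store ok' (Exp.dist_fits ok' hW (ok'.reg_lt 8) (hri.trans_lt i.2))
      ⟨ok'.reg_lt 0, by simp only [Exp.Fits]; omega, ?_⟩ fun _ => ?_
    · simp only [Exp.eval, ok'.reg_zero]
      omega
    · rw [Exp.dist_eval ok' (e := Exp.reg 8) (i := i) hri]
      simp only [Exp.eval, ok'.reg_zero]
  intro s₁ ok₁ fr₁ ag₁ h₁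
  have fr₁' : ∀ x, x ≠ 8 → s₁.reg x = s.reg x := fun x hx => fr₁ x (by simpa [Program.writes])
  have ctx₁ := hs.of_agree ok₁ ag₁ (by decide) (fr₁' 2 (by decide)) (fr₁' 3 (by decide))
    (fr₁' 4 (by decide))
  have hwu := Exp.weight_eval ctx₁.inp (e := Exp.reg 2) (i := u) ctx₁.reg_u
  rw [ctx₁.reg_c] at hwu
  refine WP.seq (WP.store ok₁ (Exp.dist_fits ok₁ hW (ok₁.reg_lt 2) (ctx₁.reg_u.trans_lt u.2))
    (Exp.weight_fits ok₁ hW (ok₁.reg_lt 2) (ctx₁.reg_u.trans_lt u.2)) fun ok₂ => ?_)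
  rw [Exp.dist_eval ok₁ (e := Exp.reg 2) (i := u) ctx₁.reg_u] at ok₂ ⊢
  set s₂ := s₁.put (addr n 2 u) ((Exp.reg 2).weight.eval s₁) with hs₂
  have ag₂ : s₁.Agree n (· ≠ 2) s₂ := State.agree_put _ _ _
  have ctx₂ := ctx₁.of_agree ok₂ ag₂ (by decide) rfl rfl rfl
  refine WP.seq (WP.fillArray (u + 3) (fun _ => 0) ok₂ (by decide) (by decide) (by omega) ?_ ?_)
  · intro i s' ok' fr hri hag
    have hu' : s'.reg 2 = u := (fr 2 (by decide)).trans ctx₂.reg_u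
    refine WP.store ok' (Exp.row_fits ok' hW (ok'.reg_lt 2) (hu'.trans_lt u.2) (ok'.reg_lt 8)
      (hri.trans_lt i.2)) (by simp only [Exp.Fits]; omega) fun _ => ?_
    rw [Exp.row_eval ok' (e := Exp.reg 2) (x := Exp.reg 8) (i := u) (j := i) hu' hri, Exp.eval]
  intro s₃ ok₃ fr₃ ag₃ h₃
  have fr₃' : ∀ x, x ≠ 8 → s₃.reg x = s₂.reg x := fun x hx => fr₃ x (by simpa [Program.writes])
  have ctx₃ := ctx₂.of_agree ok₃ ag₃ (by omega) (fr₃' 2 (by decide)) (fr₃' 3 (by decide))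
    (fr₃' 4 (by decide))
  refine WP.store ok₃ (Exp.row_fits ok₃ hW (ok₃.reg_lt 2) (ctx₃.reg_u.trans_lt u.2) (ok₃.reg_lt 2)
    (ctx₃.reg_u.trans_lt u.2)) (by simp only [Exp.Fits]; omega) fun ok₄ => ?_
  rw [Exp.row_eval ok₃ (e := Exp.reg 2) (x := Exp.reg 2) (i := u) (j := u) ctx₃.reg_u
    ctx₃.reg_u, Exp.eval] at ok₄ ⊢
  have ag₄ := s₃.agree_put (k := u + 3) u 1
  have d₄ : ∀ j : Fin n, (s₃.put (addr n (u + 3) u) 1).arr n 2 j =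
      if j = u then I.wt c u else n + 1 := by
    intro j
    rw [ag₄.arr 2 (by omega), ag₃.arr 2 (by omega), hs₂, State.arr_put, hwu, h₁, ColoredArcs.wt]
  have row₄ : (s₃.put (addr n (u + 3) u) 1).row n u = {u} := by
    ext x
    simp only [State.row, Finset.mem_filter, Finset.mem_univ, true_and, State.arr_put, h₃,
      Finset.mem_singleton]
    split_ifs with h <;> simp [h]
  have hwt : I.wt c u ≤ 1 := by unfold ColoredArcs.wt; split_ifs <;> omega
  have hn : 0 < n := u.pos
  have hsu : I.same c {u} ≤ I.wt c u := by
    rw [← insert_empty_eq]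
    exact (ColoredArcs.same_insert_le c ∅ u).trans (by simp [ColoredArcs.same, ColoredArcs.wt])
  refine post _ ok₄ (fun x hx => ?_) ?_ (fun j => ?_) ?_
  · rw [State.put_reg, fr₃' x hx, hs₂, State.put_reg, fr₁' x hx]
  · refine (((ag₁.mono ?_).trans (ag₂.mono ?_)).trans (ag₃.mono ?_)).trans (ag₄.mono ?_) <;>
    · intro k hk
      unfold Fixed at hk
      omega
  · rw [d₄ j]
    by_cases hj : j = u
    · subst hj
      rw [if_pos rfl, row₄]
      exact ⟨by omega, fun _ => ⟨ColoredArcs.spans_singleton j,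
        by simp [ColoredArcs.mem_window, ColoredArcs.offset_self], hsu⟩⟩
    · rw [if_neg hj]
      exact ⟨le_rfl, fun h => by omega⟩
  · rw [d₄ u, if_pos rfl]

theorem WP.relax (hs : Ctx I W u v c s) (hW : (n + 2) ^ 3 ≤ W) (snd : Sound I u v c s)
    {i j : Fin n} (hi : s.reg 6 = i) (hj : s.reg 7 = j)
    (post : ∀ s' : State, s'.Ok W n → s.Agree n Fixed s' → Sound I u v c s' →
      (∀ x : Fin n, s'.arr n 2 x ≤ s.arr n 2 x) →
      (I.Hits i j → j ∈ I.window u v → s'.arr n 2 j ≤ s.arr n 2 i + I.wt c j) → Q s') :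
    WP W n Program.relax s Q := by
  have h1 := cube_bounds hW
  have ok := hs.ok
  have hi_n : (Exp.reg 6).eval s < n := hi.trans_lt i.2
  have hj_n : (Exp.reg 7).eval s < n := hj.trans_lt j.2
  have fi := Exp.dist_fits ok hW (e := Exp.reg 6) (ok.reg_lt 6) hi_n
  have fj := Exp.dist_fits ok hW (e := Exp.reg 7) (ok.reg_lt 7) hj_n
  have ei := Exp.load_dist_eval ok (e := Exp.reg 6) (i := i) hi
  have ej := Exp.load_dist_eval ok (e := Exp.reg 7) (i := j) hj
  have fw := Exp.weight_fits ok hW (e := Exp.reg 7) (ok.reg_lt 7) hj_n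
  have ew : (Exp.reg 7).weight.eval s = I.wt c j := by
    rw [Exp.weight_eval hs.inp (e := Exp.reg 7) (i := j) hj, hs.reg_c, ColoredArcs.wt]
  have hwt : I.wt c j ≤ 1 := by unfold ColoredArcs.wt; split_ifs <;> omega
  have fsum : (Exp.add (Exp.load (Program.dist (Exp.reg 6))) (Exp.reg 7).weight).Fits W s := by
    refine ⟨⟨fi, ok.mem_lt _⟩, fw, ?_⟩
    rw [ei, ew]
    have := (snd i).1
    omega
  have esum : (Exp.add (Exp.load (Program.dist (Exp.reg 6))) (Exp.reg 7).weight).eval s =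
      s.arr n 2 i + I.wt c j := by rw [Exp.eval, ei, ew]
  refine WP.branch ⟨Test.inWindow_fits hs hW (ok.reg_lt 7) hj_n,
    Test.hits_fits ok hW (ok.reg_lt 6) hi_n (ok.reg_lt 7) hj_n, fsum, fj, ok.mem_lt _⟩ ?_ ?_
  · rintro ⟨hwin, hhit, hlt⟩
    rw [Test.inWindow_holds hs (e := Exp.reg 7) (i := j) hj] at hwin
    rw [Test.hits_holds hs.inp (a := Exp.reg 6) (b := Exp.reg 7) (i := i) (j := j) hi hj] at hhit
    rw [Test.Holds, esum, ej] at hlt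
    have hij : i ≠ j := fun h => by
      subst h
      omega
    have hijv : i.val ≠ j.val := fun h => hij (Fin.ext h)
    have hdj := (snd j).1
    obtain ⟨spi, subi, sami⟩ := (snd i).2 (by omega)
    refine WP.seq (WP.store ok fj fsum fun ok₁ => ?_)
    rw [esum, Exp.dist_eval ok (e := Exp.reg 7) (i := j) hj] at ok₁ ⊢
    set s₁ := s.put (addr n 2 j) (s.arr n 2 i + I.wt c j) with hs₁
    have ag₁ : s.Agree n (· ≠ 2) s₁ := State.agree_put _ _ _
    refine WP.seq (WP.fillArray (j + 3) (fun x => s₁.arr n (i + 3) x) ok₁ (by decide) (by decide)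
      (by omega) ?_ ?_)
    · intro x s' ok' fr hx hag
      have hj' : s'.reg 7 = j := (fr 7 (by decide)).trans hj
      have hi' : s'.reg 6 = i := (fr 6 (by decide)).trans hi
      refine WP.store ok' (Exp.row_fits ok' hW (ok'.reg_lt 7) (hj'.trans_lt j.2) (ok'.reg_lt 8)
        (hx.trans_lt x.2)) ⟨Exp.row_fits ok' hW (ok'.reg_lt 6) (hi'.trans_lt i.2) (ok'.reg_lt 8)
        (hx.trans_lt x.2), ok'.mem_lt _⟩ fun _ => ?_
      rw [Exp.row_eval ok' (e := Exp.reg 7) (x := Exp.reg 8) (i := j) (j := x) hj' hx, Exp.eval,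
        Exp.row_eval ok' (e := Exp.reg 6) (x := Exp.reg 8) (i := i) (j := x) hi' hx,
        ← hag.arr (i + 3) (by omega), State.arr]
    intro s₂ ok₂ fr₂ ag₂ h₂
    have hj₂ : s₂.reg 7 = j := (fr₂ 7 (by decide)).trans hj
    refine WP.store ok₂ (Exp.row_fits ok₂ hW (ok₂.reg_lt 7) (hj₂.trans_lt j.2) (ok₂.reg_lt 7)
      (hj₂.trans_lt j.2)) (by simp only [Exp.Fits]; omega) fun ok₃ => ?_
    rw [Exp.row_eval ok₂ (e := Exp.reg 7) (x := Exp.reg 7) (i := j) (j := j) hj₂ hj₂,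
      Exp.eval] at ok₃ ⊢
    have ag₃ := s₂.agree_put (k := j + 3) j 1
    have d₃ : ∀ x : Fin n, (s₂.put (addr n (j + 3) j) 1).arr n 2 x =
        if x = j then s.arr n 2 i + I.wt c j else s.arr n 2 x := by
      intro x
      rw [ag₃.arr 2 (by omega), ag₂.arr 2 (by omega), hs₁, State.arr_put]
    have row₃ : (s₂.put (addr n (j + 3) j) 1).row n j = insert j (s.row n i) := by
      ext x
      simp only [State.row, Finset.mem_filter, Finset.mem_univ, true_and, State.arr_put, h₂,
        Finset.mem_insert, ag₁.arr (i + 3) (show (i : ℕ) + 3 ≠ 2 by omega)]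
      split_ifs with h <;> simp [h]
    refine post _ ok₃ ?_ (fun x => ?_) (fun x => ?_) (fun _ _ => ?_)
    · refine ((ag₁.mono ?_).trans (ag₂.mono ?_)).trans (ag₃.mono ?_) <;>
      · intro k hk
        unfold Fixed at hk
        omega
    · rw [d₃ x]
      by_cases hx : x = j
      · subst hx
        rw [if_pos rfl, row₃]
        refine ⟨by omega, fun _ => ⟨spi.insert hhit, Finset.insert_subset hwin subi, ?_⟩⟩
        have := ColoredArcs.same_insert_le (I := I) c (s.row n i) x
        unfold ColoredArcs.wt
        omega
      · have hxj : x.val ≠ j.val := fun h => hx (Fin.ext h)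
        rw [if_neg hx, ag₃.row_eq (by omega), ag₂.row_eq (by omega), ag₁.row_eq (by omega)]
        exact snd x
    · rw [d₃ x]
      split_ifs with hx
      · rw [hx]
        exact hlt.le
      · exact le_rfl
    · rw [d₃ j, if_pos rfl]
  · intro hno
    refine WP.skip (post s ok (State.Agree.refl _ _ _) snd (fun _ => le_rfl) fun hh hw => ?_)
    by_contra hlt
    refine hno ⟨(Test.inWindow_holds hs (e := Exp.reg 7) (i := j) hj).2 hw,
      (Test.hits_holds hs.inp (a := Exp.reg 6) (b := Exp.reg 7) (i := i) (j := j) hi hj).2 hh, ?_⟩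
    rw [Test.Holds, esum, ej]
    omega

end

section

variable {W n : ℕ} {s : State} {I : ColoredArcs n} {u v : Fin n} {c : ℕ} {Q : State → Prop}

theorem WP.walks (hs : Ctx I W u v c s) (hW : (n + 2) ^ 3 ≤ W) (snd : Sound I u v c s)
    (hu : s.arr n 2 u ≤ I.wt c u)
    (post : ∀ s' : State, s'.Ok W n → (∀ x, x ∉ [5, 6, 7, 8] → s'.reg x = s.reg x) →
      s.Agree n Fixed s' → Sound I u v c s' → Lower I u v c n (fun x => s'.arr n 2 x) → Q s') :
    WP W n Program.walks s Q := by
  have h1 := cube_bounds hW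
  -- The invariants of the three loops only speak about the memory, which setting a loop counter
  -- does not change. `Lower` improves once per round of the outermost loop.
  refine WP.forLoop (fun k s' => s.Agree n Fixed s' ∧ Sound I u v c s' ∧
    s'.arr n 2 u ≤ I.wt c u ∧ Lower I u v c k (fun x => s'.arr n 2 x)) hs.ok (by decide)
    (by decide) (by omega) ⟨⟨fun _ _ => rfl, fun _ _ _ => rfl⟩, snd, hu, Lower.zero hu⟩ ?_ ?_
  swap
  · rintro s' ok' fr ⟨hag, hsnd, _, hlow⟩
    exact post s' ok' (fun x hx => fr x (by
      simp only [List.mem_cons, not_or] at hx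
      simp [Program.writes, Program.relax, Program.forLoop, hx])) hag hsnd hlow
  rintro k hk s₁ ok₁ fr₁ - ⟨ag₁, snd₁, hu₁, low₁⟩
  refine WP.forLoop (fun a s' => s₁.Agree n Fixed s' ∧ Sound I u v c s' ∧
    (∀ x : Fin n, s'.arr n 2 x ≤ s₁.arr n 2 x) ∧
    ∀ i j : Fin n, i.val < a → I.Hits i j → j ∈ I.window u v →
      s'.arr n 2 j ≤ s₁.arr n 2 i + I.wt c j) ok₁ (by decide) (by decide) (by omega)
    ⟨⟨fun _ _ => rfl, fun _ _ _ => rfl⟩, snd₁, fun _ => le_rfl,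
      fun i j hi => absurd hi (Nat.not_lt_zero _)⟩ ?_ ?_
  swap
  · rintro s' ok' fr ⟨hag, hsnd, hle, hrel⟩
    exact ⟨(ag₁.trans hag).set _ _, hsnd, (hle u).trans hu₁,
      low₁.succ hu₁ hle fun i j => hrel i j i.2⟩
  rintro a ha s₂ ok₂ fr₂ ha₂ ⟨ag₂, snd₂, le₂, rel₂⟩
  refine WP.forLoop (fun b s' => s₂.Agree n Fixed s' ∧ Sound I u v c s' ∧
    (∀ x : Fin n, s'.arr n 2 x ≤ s₂.arr n 2 x) ∧
    ∀ j : Fin n, j.val < b → I.Hits ⟨a, ha⟩ j → j ∈ I.window u v →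
      s'.arr n 2 j ≤ s₂.arr n 2 a + I.wt c j) ok₂ (by decide) (by decide) (by omega)
    ⟨⟨fun _ _ => rfl, fun _ _ _ => rfl⟩, snd₂, fun _ => le_rfl,
      fun j hj => absurd hj (Nat.not_lt_zero _)⟩ ?_ ?_
  swap
  · rintro s' ok' fr ⟨hag, hsnd, hle, hrel⟩
    refine ⟨(ag₂.trans hag).set _ _, hsnd, fun x => (hle x).trans (le₂ x), fun i j hi hij hj => ?_⟩
    by_cases hia : i.val < a
    · exact (hle j).trans (rel₂ i j hia hij hj)
    · obtain rfl : i = ⟨a, ha⟩ := Fin.ext (by simp only; omega)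
      have := le₂ ⟨a, ha⟩
      have := hrel j j.2 hij hj
      simp only [State.arr_set] at *
      omega
  rintro b hb s₃ ok₃ fr₃ hb₃ ⟨ag₃, snd₃, le₃, rel₃⟩
  have ag := (ag₁.trans ag₂).trans ag₃
  have fr : ∀ x, x ∉ [5, 6, 7, 8] → s₃.reg x = s.reg x := fun x hx => by
    simp only [List.mem_cons, not_or] at hx
    rw [fr₃ x (by simp [Program.writes, Program.relax, Program.forLoop, hx]),
      fr₂ x (by simp [Program.writes, Program.relax, Program.forLoop, hx]),
      fr₁ x (by simp [Program.writes, Program.relax, Program.forLoop, hx])]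
  have ctx := hs.of_agree ok₃ ag (Or.inr rfl) (fr 2 (by decide)) (fr 3 (by decide))
    (fr 4 (by decide))
  refine WP.relax ctx hW snd₃ (i := ⟨a, ha⟩) (j := ⟨b, hb⟩)
    ((fr₃ 6 (by decide)).trans ha₂) hb₃ ?_
  intro s' ok' hag hsnd hle hrel
  refine ⟨(ag₃.trans hag).set _ _, hsnd, fun x => (hle x).trans (le₃ x), fun j hj hij hjw => ?_⟩
  by_cases hjb : j.val < b
  · exact (hle j).trans (rel₃ j hjb hij hjw)
  · obtain rfl : j = ⟨b, hb⟩ := Fin.ext (by simp only; omega)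
    have := le₃ ⟨a, ha⟩
    have := hrel hij hjw
    simp only [State.arr_set] at *
    omega

/-! ### Updating the output -/

theorem WP.copyWalk (hs : Ctx I W u v c s) (hW : (n + 2) ^ 3 ≤ W)
    (post : ∀ s' : State, s'.Ok W n → (∀ x, x ≠ 8 → s'.reg x = s.reg x) →
      s.Agree n (· ≠ 0) s' → s'.output n = s.row n v → Q s') :
    WP W n Program.copyWalk s Q := by
  have h1 := cube_bounds hW
  refine WP.fillArray 0 (fun x => s.arr n (v + 3) x) hs.ok (by decide) (by decide) (by omega) ?_ ?_
  · intro i s' ok' fr hri hag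
    have hv : s'.reg 3 = v := (fr 3 (by decide)).trans hs.reg_v
    refine WP.store ok' (Exp.out_fits ok' hW (ok'.reg_lt 8) (hri.trans_lt i.2))
      ⟨Exp.row_fits ok' hW (ok'.reg_lt 3) (hv.trans_lt v.2) (ok'.reg_lt 8) (hri.trans_lt i.2),
        ok'.mem_lt _⟩ fun _ => ?_
    rw [Exp.out_eval ok' (e := Exp.reg 8) (i := i) hri, Exp.eval,
      Exp.row_eval ok' (e := Exp.reg 3) (x := Exp.reg 8) (i := v) (j := i) hv hri,
      ← hag.arr (v + 3) (by omega), State.arr]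
  · intro s' ok' fr hag h
    refine post s' ok' (fun x hx => fr x (by simpa [Program.writes])) hag ?_
    ext x
    simp only [State.mem_output, State.row, h, Finset.mem_filter, Finset.mem_univ, true_and]

theorem WP.countOut (hs : Ctx I W u v c s) (hW : (n + 2) ^ 3 ≤ W)
    (post : ∀ s' : State, s'.Ok W n → (∀ x, x ∉ [8, 12] → s'.reg x = s.reg x) →
      s'.mem = s.mem → s'.reg 12 = I.same c (s.output n) → Q s') :
    WP W n Program.countOut s Q := by
  have h1 := cube_bounds hW
  refine WP.seq (WP.assign hs.ok (by decide) (by simp only [Exp.Fits]; omega) fun ok₁ => ?_)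
  refine WP.forLoop (fun i s' => s'.mem = s.mem ∧
    s'.reg 12 = (Finset.univ.filter fun x : Fin n =>
      x.val < i ∧ (x ∈ s.output n ∧ I.colorWord x = c)).card) ok₁ (by decide) (by decide)
    (by omega) ?_ ?_ ?_
  · simp [Exp.eval]
  · rintro i hi s' ok' fr hri ⟨hm, h12⟩
    have hm' : ∀ k x, s'.arr n k x = s.arr n k x := fun k x => by rw [State.arr, hm, State.arr]
    have ctx : Ctx I W u v c s' := hs.of_agree ok' (K := fun _ => True)
      ⟨fun a _ => by rw [hm], fun k _ x => hm' k x⟩ trivial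
      (fr 2 (by decide)) (fr 3 (by decide)) (fr 4 (by decide))
    have hin := card_filter_lt_succ (fun x => x ∈ s.output n ∧ I.colorWord x = c) ⟨i, hi⟩
    have hb : (Exp.reg 8).eval s' = (⟨i, hi⟩ : Fin n) := hri
    have b12 : s'.reg 12 ≤ n :=
      h12.trans_le ((Finset.card_le_univ _).trans (Fintype.card_fin n).le)
    have fw := Exp.weight_fits ok' hW (e := Exp.reg 8) (ok'.reg_lt 8) (hb.trans_lt hi)
    have ew := Exp.weight_eval ctx.inp hb
    rw [ctx.reg_c] at ew
    have ewle : (Exp.reg 8).weight.eval s' ≤ 1 := by rw [ew]; split_ifs <;> omega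
    have hout : (Test.eq (Exp.load (Program.out (Exp.reg 8))) (Exp.const 1)).Holds s' ↔
        ⟨i, hi⟩ ∈ s.output n := by
      rw [State.mem_output, ← hm']
      simp only [Test.Holds, Exp.eval, Exp.out_eval ok' hb, State.arr]
    refine WP.branch ⟨⟨Exp.out_fits ok' hW (ok'.reg_lt 8) (hb.trans_lt hi), ok'.mem_lt _⟩,
      by simp only [Exp.Fits]; omega⟩ ?_ ?_
    · intro h
      rw [hout] at h
      refine WP.assign ok' (by decide) ⟨ok'.reg_lt 12, fw, ?_⟩ fun _ => ⟨hm, ?_⟩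
      · simp only [Exp.eval]
        omega
      · rw [hin, ← h12]
        simp only [Exp.eval, State.set_reg, ew, h, true_and]
        simp
    · intro h
      rw [hout] at h
      refine WP.skip ⟨hm, ?_⟩
      rw [hin, ← h12]
      simp [h]
  · rintro s' ok' fr ⟨hm, h12⟩
    refine post s' ok' (fun x hx => ?_) hm ?_
    · have hx' : x ≠ 8 ∧ x ≠ 12 := by simpa using hx
      rw [fr x (by simpa [Program.writes] using hx')]
      simp [hx'.2]
    · rw [h12, ColoredArcs.same]
      congr 1
      ext x
      simp

theorem State.output_eq_of_agree {K : ℕ → Prop} {s' : State} (h : s.Agree n K s') (hK : K 0) :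
    s'.output n = s.output n := by
  ext x
  simp only [State.mem_output, h.arr 0 hK]

theorem State.output_put (s : State) (i : Fin n) :
    (s.put (addr n 0 i) 1).output n = insert i (s.output n) := by
  ext x
  simp only [State.mem_output, State.arr_put, Finset.mem_insert]
  split_ifs with h <;> simp [h]

theorem WP.fill (hs : Ctx I W u v c s) (hW : (n + 2) ^ 3 ≤ W)
    (hsub : s.output n ⊆ I.window u v) (h12 : s.reg 12 = I.same c (s.output n))
    (h10 : s.reg 10 = I.diff c (I.window u v)) (hle : s.reg 12 ≤ s.reg 10)
    (hmaj : s.reg 10 ≤ I.same c (I.window u v))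
    (post : ∀ s' : State, s'.Ok W n → (∀ x, x ∉ [8, 12] → s'.reg x = s.reg x) →
      s.Agree n (· ≠ 0) s' → s.output n ⊆ s'.output n → s'.output n ⊆ I.window u v →
      I.same c (s'.output n) = s.reg 10 → I.diff c (s'.output n) = s.reg 10 → Q s') :
    WP W n Program.fill s Q := by
  have h1 := cube_bounds hW
  refine WP.forLoop (fun i s' => s.Agree n (· ≠ 0) s' ∧ s.output n ⊆ s'.output n ∧
    s'.output n ⊆ I.window u v ∧ s'.reg 12 = I.same c (s'.output n) ∧ s'.reg 12 ≤ s.reg 10 ∧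
    ∀ x : Fin n, x.val < i → x ∈ I.window u v →
      x ∈ s'.output n ∨ (I.colorWord x = c ∧ s'.reg 12 = s.reg 10)) hs.ok (by decide)
    (by decide) (by omega) ?_ ?_ ?_
  · refine ⟨⟨fun _ _ => rfl, fun _ _ _ => rfl⟩, Finset.Subset.refl _, hsub, ?_, ?_,
      fun x hx => absurd hx (Nat.not_lt_zero _)⟩
    · simpa using h12
    · simpa using hle
  · rintro i hi s' ok' fr hri ⟨hag, hS, hU, i12, ile, hdone⟩
    have ctx := hs.of_agree ok' hag (by decide) (fr 2 (by decide)) (fr 3 (by decide))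
      (fr 4 (by decide))
    have r10 : s'.reg 10 = s.reg 10 := fr 10 (by decide)
    have hb : (Exp.reg 8).eval s' = (⟨i, hi⟩ : Fin n) := hri
    have fw := Exp.weight_fits ok' hW (e := Exp.reg 8) (ok'.reg_lt 8) (hb.trans_lt hi)
    have ew := Exp.weight_eval ctx.inp hb
    rw [ctx.reg_c] at ew
    have fone : (Exp.const 1).Fits W s' := by simp only [Exp.Fits]; omega
    have fo := Exp.out_fits ok' hW (e := Exp.reg 8) (ok'.reg_lt 8) (hb.trans_lt hi)
    have eo := Exp.out_eval ok' hb
    have hput : s'.Agree n (· ≠ 0) (s'.put (addr n 0 (⟨i, hi⟩ : Fin n)) 1) := State.agree_put _ _ _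
    have hout : (Test.eq (Exp.load (Program.out (Exp.reg 8))) (Exp.const 1)).Holds s' ↔
        ⟨i, hi⟩ ∈ s'.output n := by
      rw [State.mem_output]
      simp only [Test.Holds, Exp.eval, eo, State.arr]
    -- Every vertex up to `i` is treated if `i` is and if nothing was lost.
    have ext : ∀ s'' : State, s'.output n ⊆ s''.output n →
        (s'.reg 12 = s.reg 10 → s''.reg 12 = s.reg 10) →
        ((⟨i, hi⟩ : Fin n) ∈ I.window u v → ⟨i, hi⟩ ∈ s''.output n ∨
          (I.colorWord ⟨i, hi⟩ = c ∧ s''.reg 12 = s.reg 10)) →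
        ∀ x : Fin n, x.val < i + 1 → x ∈ I.window u v →
          x ∈ s''.output n ∨ (I.colorWord x = c ∧ s''.reg 12 = s.reg 10) := by
      intro s'' h h' hi' x hx hxw
      by_cases hxi : x.val < i
      · rcases hdone x hxi hxw with hd | hd
        exacts [Or.inl (h hd), Or.inr ⟨hd.1, h' hd.2⟩]
      · obtain rfl : x = ⟨i, hi⟩ := Fin.ext (by simp only; omega)
        exact hi' hxw
    refine WP.branch ⟨Test.inWindow_fits ctx hW (ok'.reg_lt 8) (hb.trans_lt hi),
      ⟨fo, ok'.mem_lt _⟩, fone⟩ ?_ ?_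
    · rintro ⟨hwin, hno⟩
      rw [Test.inWindow_holds ctx hb] at hwin
      rw [Test.Holds, hout] at hno
      have hsame := ColoredArcs.same_insert_of_notMem (I := I) (c := c) hno
      have hwt : (Test.eq (Exp.reg 8).weight (Exp.const 1)).Holds s' ↔ I.colorWord ⟨i, hi⟩ = c := by
        rw [Test.Holds, ew, Exp.eval]
        simp
      refine WP.branch ⟨fw, fone⟩ ?_ ?_
      · intro hcol
        rw [hwt] at hcol
        rw [if_pos hcol] at hsame
        refine WP.branch ⟨ok'.reg_lt 12, ok'.reg_lt 10⟩ ?_ ?_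
        · intro hlt
          simp only [Test.Holds, Exp.eval, r10] at hlt
          refine WP.seq (WP.store ok' fo fone fun ok'' => ?_)
          rw [eo, Exp.eval] at ok'' ⊢
          refine WP.assign ok'' (by decide) ⟨ok''.reg_lt 12, fone, ?_⟩ fun _ => ?_
          · have := ok'.reg_lt 10
            simp only [Exp.eval, State.put_reg]
            omega
          · have ho := s'.output_put ⟨i, hi⟩
            have ho' : ∀ a b a' b', (((s'.put (addr n 0 i) 1).set a b).set a' b').output n =
              insert ⟨i, hi⟩ (s'.output n) := fun _ _ _ _ => ho
            refine ⟨((hag.trans hput).set _ _).set _ _, ?_, ?_, ?_, ?_, ext _ ?_ ?_ ?_⟩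
            · rw [ho']
              exact hS.trans (Finset.subset_insert _ _)
            · rw [ho']
              exact Finset.insert_subset hwin hU
            · rw [ho', hsame, ← i12]
              simp [Exp.eval]
            · simp only [State.set_reg, Exp.eval, State.put_reg]
              simp
              omega
            · rw [ho']
              exact Finset.subset_insert _ _
            · intro h
              omega
            · intro _
              rw [ho']
              exact Or.inl (Finset.mem_insert_self _ _)
        · intro hlt
          simp only [Test.Holds, Exp.eval, r10] at hlt
          have h12' : s'.reg 12 = s.reg 10 := by omega
          refine WP.skip ⟨hag.set _ _, hS, hU, ?_, ?_, ext _ (Finset.Subset.refl _) ?_ ?_⟩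
          · simpa using i12
          · simpa using ile
          · simp
          · exact fun _ => Or.inr ⟨hcol, by simpa using h12'⟩
      · intro hcol
        rw [hwt] at hcol
        rw [if_neg hcol] at hsame
        refine WP.store ok' fo fone fun ok'' => ?_
        rw [eo, Exp.eval] at ok'' ⊢
        have ho := s'.output_put ⟨i, hi⟩
        have ho' : ∀ a b, ((s'.put (addr n 0 i) 1).set a b).output n =
          insert ⟨i, hi⟩ (s'.output n) := fun _ _ => ho
        refine ⟨(hag.trans hput).set _ _, ?_, ?_, ?_, ?_, ext _ ?_ ?_ ?_⟩
        · rw [ho']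
          exact hS.trans (Finset.subset_insert _ _)
        · rw [ho']
          exact Finset.insert_subset hwin hU
        · rw [ho', hsame, ← i12]
          simp
        · simpa using ile
        · rw [ho']
          exact Finset.subset_insert _ _
        · simp
        · intro _
          rw [ho']
          exact Or.inl (Finset.mem_insert_self _ _)
    · intro hno
      refine WP.skip ⟨hag.set _ _, hS, hU, ?_, ?_, ext _ (Finset.Subset.refl _) ?_ ?_⟩
      · simpa using i12
      · simpa using ile
      · simp
      · intro hwin
        refine Or.inl ?_
        by_contra hcon
        exact hno ⟨(Test.inWindow_holds ctx hb).2 hwin, fun h => hcon (hout.1 h)⟩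
  · rintro s' ok' fr ⟨hag, hS, hU, i12, ile, hdone⟩
    refine post s' ok' (fun x hx => fr x (by simpa [Program.writes] using hx)) hag hS hU ?_ ?_
    · refine le_antisymm (by omega) ?_
      by_contra hlt
      have : I.window u v ⊆ s'.output n := fun x hx => (hdone x x.2 hx).resolve_right
        fun h => by omega
      have := ColoredArcs.same_mono (I := I) (c := c) this
      omega
    · rw [h10]
      refine le_antisymm (ColoredArcs.diff_mono hU) (Finset.card_le_card fun x hx => ?_)
      rw [Finset.mem_filter] at hx ⊢
      exact ⟨(hdone x x.2 hx.1).resolve_right fun h => hx.2 h.1, hx.2⟩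

/-- The output is a solution with `reg 11` arcs of each color. -/
def Valid (I : ColoredArcs n) (s : State) : Prop :=
  IsBalancedConnected I.graph I.color (s.output n) ∧ (s.output n).card = 2 * s.reg 11

theorem WP.candidate (hs : Ctx I W u v c s) (hc : c = 0 ∨ c = 1) (hW : (n + 2) ^ 3 ≤ W)
    (val : Valid I s)
    (post : ∀ s' : State, s'.Ok W n → (∀ x, x ∉ [5, 6, 7, 8, 9, 10, 11, 12] → s'.reg x = s.reg x) →
      s.Agree n (· = 1) s' → Valid I s' → s.reg 11 ≤ s'.reg 11 →
      (∀ m, I.Candidate u v c m → m ≤ s'.reg 11) → Q s') :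
    WP W n Program.candidate s Q := by
  refine WP.seq (WP.count hs hW fun s₁ ok₁ fr₁ hm₁ h9 h10 => ?_)
  have ag₁ : s.Agree n (fun _ => True) s₁ :=
    ⟨fun a _ => by rw [hm₁], fun k _ x => by rw [State.arr, hm₁, State.arr]⟩
  have ctx₁ := hs.of_agree ok₁ ag₁ trivial (fr₁ 2 (by decide)) (fr₁ 3 (by decide))
    (fr₁ 4 (by decide))
  refine WP.seq (WP.init ctx₁ hW fun s₂ ok₂ fr₂ ag₂ snd₂ hu₂ => ?_)
  have ctx₂ := ctx₁.of_agree ok₂ ag₂ (Or.inr rfl) (fr₂ 2 (by decide)) (fr₂ 3 (by decide))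
    (fr₂ 4 (by decide))
  refine WP.seq (WP.walks ctx₂ hW snd₂ hu₂ fun s₃ ok₃ fr₃ ag₃ snd₃ low₃ => ?_)
  have ctx₃ := ctx₂.of_agree ok₃ ag₃ (Or.inr rfl) (fr₃ 2 (by decide)) (fr₃ 3 (by decide))
    (fr₃ 4 (by decide))
  have ag : s.Agree n Fixed s₃ := ((ag₁.mono fun _ _ => trivial).trans ag₂).trans ag₃
  have fr : ∀ x, x ∉ [5, 6, 7, 8, 9, 10] → s₃.reg x = s.reg x := fun x hx => by
    simp only [List.mem_cons, not_or] at hx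
    rw [fr₃ x (by simp [hx]), fr₂ x hx.2.2.2.1, fr₁ x (by simp [hx])]
  have e9 : s₃.reg 9 = I.same c (I.window u v) := by
    rw [fr₃ 9 (by decide), fr₂ 9 (by decide), h9]
  have e10 : s₃.reg 10 = I.diff c (I.window u v) := by
    rw [fr₃ 10 (by decide), fr₂ 10 (by decide), h10]
  have e11 : s₃.reg 11 = s.reg 11 := fr 11 (by decide)
  have val₃ : Valid I s₃ := by
    rw [Valid, State.output_eq_of_agree ag (Or.inl rfl), e11]
    exact val
  have hv_n := ctx₃.reg_v.trans_lt v.2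
  have ed := Exp.load_dist_eval ok₃ (e := Exp.reg 3) (i := v) ctx₃.reg_v
  -- The walk to `v` found by the search is as good as that of any candidate.
  have hcand : ∀ m, I.Candidate u v c m → m ≤ s₃.reg 10 ∧ s₃.reg 10 ≤ s₃.reg 9 ∧
      s₃.arr n 2 v ≤ s₃.reg 10 := by
    rintro m ⟨hmaj, rfl, S, hSw, huS, hvS, hr, hle⟩
    rw [e9, e10]
    refine ⟨le_rfl, hmaj, (low₃ S hSw ?_ huS v hvS hr).trans hle⟩
    exact ((Finset.card_le_univ S).trans (Fintype.card_fin n).le).trans (Nat.le_succ n)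
  refine WP.branch ⟨⟨ok₃.reg_lt 9, ok₃.reg_lt 10⟩, ⟨ok₃.reg_lt 10,
    Exp.dist_fits ok₃ hW (ok₃.reg_lt 3) hv_n, ok₃.mem_lt _⟩, ok₃.reg_lt 11, ok₃.reg_lt 10⟩ ?_ ?_
  · rintro ⟨hmaj, hdist, hbest⟩
    simp only [Test.Holds] at hmaj hdist hbest
    rw [ed] at hdist
    simp only [Exp.eval, not_lt] at hmaj hdist hbest
    have hdn : s₃.arr n 2 v ≤ n := by
      refine hdist.trans ?_
      rw [e10]
      exact (Finset.card_le_univ _).trans (Fintype.card_fin n).le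
    obtain ⟨spv, subv, samev⟩ := (snd₃ v).2 hdn
    refine WP.seq (WP.assign ok₃ (by decide) (ok₃.reg_lt 10) fun ok₄ => ?_)
    have ag₄ : s₃.Agree n (fun _ => True) (s₃.set 11 ((Exp.reg 10).eval s₃)) :=
      ⟨fun _ _ => rfl, fun _ _ _ => rfl⟩
    have ctx₄ := ctx₃.of_agree ok₄ ag₄ trivial (by simp) (by simp) (by simp)
    refine WP.seq (WP.copyWalk ctx₄ hW fun s₅ ok₅ fr₅ ag₅ out₅ => ?_)
    have ctx₅ := ctx₄.of_agree ok₅ ag₅ (by decide) (fr₅ 2 (by decide)) (fr₅ 3 (by decide))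
      (fr₅ 4 (by decide))
    rw [ag₄.row_eq trivial] at out₅
    refine WP.seq (WP.countOut ctx₅ hW fun s₆ ok₆ fr₆ hm₆ h12 => ?_)
    have ag₆ : s₅.Agree n (fun _ => True) s₆ :=
      ⟨fun a _ => by rw [hm₆], fun k _ x => by rw [State.arr, hm₆, State.arr]⟩
    have ctx₆ := ctx₅.of_agree ok₆ ag₆ trivial (fr₆ 2 (by decide)) (fr₆ 3 (by decide))
      (fr₆ 4 (by decide))
    have out₆ : s₆.output n = s₃.row n v := by
      rw [State.output_eq_of_agree ag₆ trivial, out₅]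
    have f6 : ∀ x, x ∉ [8, 11, 12] → s₆.reg x = s₃.reg x := fun x hx => by
      simp only [List.mem_cons, not_or] at hx
      rw [fr₆ x (by simp [hx]), fr₅ x hx.1, State.set_reg, if_neg hx.2.1]
    have e10' : s₆.reg 10 = s₃.reg 10 := f6 10 (by decide)
    have e11' : s₆.reg 11 = s₃.reg 10 := by
      rw [fr₆ 11 (by decide), fr₅ 11 (by decide)]
      simp [Exp.eval]
    rw [out₅] at h12
    refine WP.fill ctx₆ hW (by rw [out₆]; exact subv) (by rw [out₆, h12]) (by rw [e10', e10])
      (by rw [e10', h12]; omega) (by rw [e10', ← e9]; exact hmaj) ?_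
    intro s₇ ok₇ fr₇ ag₇ hS hU hsame hdiff
    have e11'' : s₇.reg 11 = s₃.reg 10 := (fr₇ 11 (by decide)).trans e11'
    refine post s₇ ok₇ (fun x hx => ?_) ?_ ⟨⟨?_, ?_⟩, ?_⟩ (by omega) (fun m hm => ?_)
    · simp only [List.mem_cons, not_or] at hx
      rw [fr₇ x (by simp [hx]), f6 x (by simp [hx]), fr x (by simp [hx])]
    · exact (((ag.mono fun k hk => Or.inr hk).trans (ag₄.mono fun _ _ => trivial)).trans
        (ag₅.mono fun k hk => by omega)).trans ((ag₆.mono fun _ _ => trivial).trans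
        (ag₇.mono fun k hk => by omega))
    · rw [out₆] at hS
      exact spv.preconnected hS fun i hi => ColoredArcs.mem_window.1 (hU hi)
    · exact (ColoredArcs.isBalanced_iff hc).2 (hsame.trans hdiff.symm)
    · have := I.same_add_diff c (s₇.output n)
      omega
    · have := (hcand m hm).1
      omega
  · intro hno
    refine WP.skip (post s₃ ok₃ (fun x hx => fr x ?_) (ag.mono fun k hk => Or.inr hk) val₃
      e11.ge ?_)
    · simp only [List.mem_cons, not_or] at hx
      simp [hx]
    · intro m hm
      obtain ⟨h1, h2, h3⟩ := hcand m hm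
      by_contra hlt
      refine hno ⟨?_, ?_, ?_⟩
      · simp only [Test.Holds, Exp.eval]
        omega
      · simp only [Test.Holds]
        rw [ed]
        simp only [Exp.eval]
        omega
      · simp only [Test.Holds, Exp.eval]
        omega

/-! ### The algorithm on an input -/

theorem inputState_hasInput (I : ColoredArcs n) : I.inputState.HasInput I where
  len := rfl
  left i := by
    have : I.inputMem (3 * i + 2) = I.left i := by
      simp [ColoredArcs.inputMem]
    rwa [add_comm] at this
  right i := by
    have h : (3 * (i : ℕ) + 1) / 3 = i := by omega
    have : I.inputMem (3 * i + 1 + 2) = I.right i := by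
      simp [ColoredArcs.inputMem, h, Nat.add_mod]
    rwa [show 3 * (i : ℕ) + 1 + 2 = 3 + 3 * i by omega] at this
  color i := by
    have h : (3 * (i : ℕ) + 2) / 3 = i := by omega
    have : I.inputMem (3 * i + 2 + 2) = I.colorWord i := by
      simp [ColoredArcs.inputMem, h, Nat.add_mod, ColoredArcs.colorWord]
    rwa [show 3 * (i : ℕ) + 2 + 2 = 4 + 3 * i by omega] at this

theorem inputMem_lt (I : ColoredArcs n) (hW : (n + 2) ^ 3 ≤ W) (hlen : I.len < W)
    (hr : ∀ i, I.right i < W) (a : ℕ) : I.inputMem a < W := by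
  have h1 := cube_bounds hW
  match a with
  | 0 => simp only [ColoredArcs.inputMem]; omega
  | 1 => exact hlen
  | a + 2 =>
    simp only [ColoredArcs.inputMem]
    split_ifs with h
    · exact (I.left_lt _).trans hlen
    · exact hr _
    all_goals omega

theorem inputState_output (I : ColoredArcs n) : I.inputState.output n = ∅ := by
  ext i
  have h : ¬ (3 * n + i.val) / 3 < n := by omega
  have : I.inputMem (3 * n + i.val + 2) = 0 := by
    simp only [ColoredArcs.inputMem, dif_neg h]
  rw [show 3 * n + i.val + 2 = addr n 0 i by unfold addr; omega] at this
  simp [State.mem_output, State.arr, ColoredArcs.inputState, this]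

theorem WP.main (I : ColoredArcs n) (hW : (n + 2) ^ 3 ≤ W) (hlen : I.len < W)
    (hr : ∀ i, I.right i < W) :
    WP W n Program.main I.inputState fun s => IsMaximumBCS I.graph I.color (s.output n) := by
  have h1 := cube_bounds hW
  have hmem := inputMem_lt I hW hlen hr
  have ok₀ : (I.inputState.set 0 ((Exp.load (Exp.const 0)).eval I.inputState)).Ok W n := by
    refine ⟨fun r => ?_, hmem, by simp [Exp.eval, ColoredArcs.inputState, ColoredArcs.inputMem]⟩
    rw [State.set_reg]
    split_ifs
    · exact hmem 0
    · simp only [ColoredArcs.inputState]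
      omega
  have inp₀ : (I.inputState.set 0 ((Exp.load (Exp.const 0)).eval I.inputState)).HasInput I :=
    (inputState_hasInput I).of_agree (K := fun _ => True) ((State.Agree.refl _ _ _).set _ _)
  have fits₀ : (Exp.load (Exp.const 0)).Fits W I.inputState :=
    ⟨by simp only [Exp.Fits]; omega, hmem 0⟩
  have val₀ : ∀ a b c d, Valid I ((I.inputState.set a b).set c d) ∨ a = 11 ∨ c = 11 := by
    intro a b c d
    by_cases h : a = 11 ∨ c = 11
    · exact Or.inr h
    · push Not at h
      refine Or.inl ⟨?_, ?_⟩
      · rw [State.output_set, State.output_set, inputState_output]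
        exact ⟨fun x => absurd x.2 (by simp), by simp [IsBalanced]⟩
      · rw [State.output_set, State.output_set, inputState_output]
        simp [h.1.symm, h.2.symm, ColoredArcs.inputState]
  refine WP.seq ⟨_, _, Exec.assign 0 (Exp.load (Exp.const 0)) I.inputState fits₀, le_rfl, ?_⟩
  refine WP.forLoop (fun a s' => s'.HasInput I ∧ Valid I s' ∧
    ∀ u v : Fin n, ∀ c m, u.val < a → (c = 0 ∨ c = 1) → I.Candidate u v c m → m ≤ s'.reg 11)
    ok₀ (by decide) (by decide) (by omega) ⟨⟨inp₀.len, inp₀.left, inp₀.right, inp₀.color⟩,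
      (val₀ _ _ _ _).resolve_right (by decide), fun u v c m h => absurd h (Nat.not_lt_zero _)⟩ ?_ ?_
  · rintro a ha s₁ ok₁ - ha₁ ⟨inp₁, val₁, done₁⟩
    refine WP.seq (WP.offsets (u := ⟨a, ha⟩) ok₁ hW inp₁ ha₁ fun s₂ ok₂ fr₂ ag₂ off₂ => ?_)
    have val₂ : Valid I s₂ := by
      rw [Valid, State.output_eq_of_agree ag₂ (by decide), fr₂ 11 (by decide)]
      exact val₁
    have e11 : s₂.reg 11 = s₁.reg 11 := fr₂ 11 (by decide)
    refine WP.forLoop (fun b s' => s₂.Agree n (· = 1) s' ∧ Valid I s' ∧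
      s₂.reg 11 ≤ s'.reg 11 ∧
      ∀ v : Fin n, ∀ c m, v.val < b → (c = 0 ∨ c = 1) → I.Candidate ⟨a, ha⟩ v c m →
        m ≤ s'.reg 11) ok₂ (by decide) (by decide) (by omega)
      ⟨(State.Agree.refl _ _ _).set _ _, val₂, by simp,
        fun v c m h => absurd h (Nat.not_lt_zero _)⟩ ?_ ?_
    · rintro b hb s₃ ok₃ fr₃ hb₃ ⟨ag₃, val₃, le₃, done₃⟩
      have hu₃ : s₃.reg 2 = a := by rw [fr₃ 2 (by decide), fr₂ 2 (by decide), ha₁]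
      have ctx : ∀ c : ℕ, ∀ s' : State, s'.Ok W n → s₃.Agree n (· = 1) s' → s'.reg 2 = s₃.reg 2 →
          s'.reg 3 = s₃.reg 3 → s'.reg 4 = c → Ctx I W ⟨a, ha⟩ ⟨b, hb⟩ c s' :=
        fun c s' ok' ag' h2 h3 h4 =>
          ⟨ok', ((inp₁.of_agree ag₂).of_agree ag₃).of_agree ag',
            fun x => (ag'.arr 1 rfl x).trans ((ag₃.arr 1 rfl x).trans (off₂ x)),
            h2.trans hu₃, h3.trans hb₃, h4⟩
      refine WP.seq (WP.assign ok₃ (by decide) (by simp only [Exp.Fits]; omega) fun ok₄ => ?_)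
      have ag₄ := (State.Agree.refl n (· = 1) s₃).set 4 ((Exp.const 0).eval s₃)
      refine WP.seq (WP.candidate (ctx 0 _ ok₄ ag₄ (by simp) (by simp) (by simp [Exp.eval]))
        (Or.inl rfl) hW ?_ fun s₅ ok₅ fr₅ ag₅ val₅ le₅ cand₅ => ?_)
      · exact val₃
      refine WP.seq (WP.assign ok₅ (by decide) (by simp only [Exp.Fits]; omega) fun ok₆ => ?_)
      have ag₆ := (ag₄.trans ag₅).set 4 ((Exp.const 1).eval s₅)
      refine WP.candidate (ctx 1 _ ok₆ ag₆ ?_ ?_ (by simp [Exp.eval]))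
        (Or.inr rfl) hW ?_ fun s₇ ok₇ fr₇ ag₇ val₇ le₇ cand₇ => ?_
      · simp [fr₅ 2 (by decide)]
      · simp [fr₅ 3 (by decide)]
      · exact val₅
      simp only [State.set_reg, Nat.reduceEqDiff, if_false] at le₅ le₇
      refine ⟨(ag₃.trans (ag₆.trans ag₇)).set _ _, val₇, ?_, fun v c m hv hc hm => ?_⟩
      · simp only [State.set_reg, Nat.reduceEqDiff, if_false]
        omega
      · simp only [State.set_reg, Nat.reduceEqDiff, if_false]
        by_cases hvb : v.val < b
        · have := done₃ v c m hvb hc hm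
          omega
        · obtain rfl : v = ⟨b, hb⟩ := Fin.ext (by simp only; omega)
          rcases hc with rfl | rfl
          · have := cand₅ m hm
            omega
          · exact cand₇ m hm
    · rintro s' ok' fr ⟨hag, hval, hle, hdone⟩
      refine ⟨(inp₁.of_agree ag₂).of_agree (hag.set _ _), hval, fun u v c m hu hc hm => ?_⟩
      simp only [State.set_reg, Nat.reduceEqDiff, if_false]
      by_cases hua : u.val < a
      · have := done₁ u v c m hua hc hm
        omega
      · obtain rfl : u = ⟨a, ha⟩ := Fin.ext (by simp only; omega)
        exact hdone v c m v.2 hc hm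
  · rintro s' ok' fr ⟨_, hval, hdone⟩
    refine ⟨hval.1, fun H hH => ?_⟩
    rcases H.eq_empty_or_nonempty with rfl | hne
    · simp
    · obtain ⟨u, v, c, m, hc, hm, hle⟩ := ColoredArcs.exists_candidate hne hH
      have := hdone u v c m u.2 hc hm
      have := hval.2
      omega

end

end BCS

theorem mainTheorem2 :
    ∃ (P : BCS.Program) (k : ℕ) (T : ℕ → ℕ),
      ((fun n : ℕ => (T n : ℝ)) =O[atTop] fun n : ℕ => (n : ℝ) ^ 6 * Real.log (n : ℝ)) ∧
      ∀ (n : ℕ) (I : BCS.ColoredArcs n) (W : ℕ),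
        (n + 2) ^ k ≤ W → I.len < W → (∀ i : Fin n, I.right i < W) →
        ∃ (t : ℕ) (s : BCS.State),
          BCS.Exec W P I.inputState t s ∧
          t ≤ T n ∧
          BCS.IsMaximumBCS I.graph I.color (s.output n) := by
  obtain ⟨C, hC⟩ := BCS.Program.main.exists_time_le
  refine ⟨BCS.Program.main, 3, fun n => BCS.Program.main.time n, ?_, fun n I W hW hlen hr =>
    BCS.WP.main I hW hlen hr⟩
  refine IsBigO.of_bound (C * 2 ^ 6 : ℕ) ?_
  filter_upwards [eventually_ge_atTop 3] with n hn
  have hdepth : BCS.Program.main.depth = 6 := rfl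
  have h1 : BCS.Program.main.time n ≤ C * 2 ^ 6 * n ^ 6 := by
    refine (hC n).trans ?_
    rw [hdepth, mul_assoc, ← mul_pow]
    exact Nat.mul_le_mul_left _ (Nat.pow_le_pow_left (by omega) _)
  have hlog : 1 ≤ Real.log n := by
    rw [Real.le_log_iff_exp_le (by positivity)]
    have : (3 : ℝ) ≤ n := by exact_mod_cast hn
    linarith [Real.exp_one_lt_d9]
  have h2 : (BCS.Program.main.time n : ℝ) ≤ (C * 2 ^ 6 : ℕ) * (n : ℝ) ^ 6 := by exact_mod_cast h1
  rw [Real.norm_of_nonneg (by positivity), Real.norm_of_nonneg (by positivity)]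
  refine h2.trans ?_
  gcongr
  exact le_mul_of_one_le_right (by positivity) hlog
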